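/- **Setting.** Fix constants $\beta>1$, $\varepsilon\in(0,1)$, $\omega>1$, $\omega'>1$ and an integer $K^*$. For label vectors $z\in[K]^n$ and a symmetric matrix $P\in[0,1]^{K\times K}$, the stochastic block model $\mathrm{SBM}(z,P)$ is the law of the random symmetric matrix $A\in\{0,1\}^{n\times n}$ with $A_{ii}=0$ and with independent entries $A_{ij}=A_{ji}\sim\mathrm{Bern}(P_{z_iz_j})$, $i>j$. An estimator $\hat z$ is a (possibly randomized) function of $A$ with values in $[K]^n$, and its misclassification rate is $$\mathrm{mis}(\hat z,z)=\min_{\pi\in S_K}\frac1n\sum_{i=1}^n \mathbf 1\{\pi(\hat z_i)\neq z_i\}.$$ For two probability laws on a countable set with mass functions $\varphi_0,\varphi_1$, the Chernoff information is $$D(\varphi_0\|\varphi_1)=\sup_{0<\alpha<1}\Big(-\log\sum_x\varphi_0(x)^{1-\alpha}\varphi_1(x)^{\alpha}\Big).$$ For $p^*\in(0,1)$ and $D^*\in\mathbb R$ let $\mathcal S(n,p^*,K,D^*)$ be the set of all $(z,P)$ with $z\in[K]^n$, $P\in(0,1)^{K\times K}$, $P=P^\top$, such that * $\frac{n}{\beta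 K}\le|\{i:z_i=k\}|\le\frac{\beta n}{K}$ for all $k\in[K]$; * $\max_{k,\ell}P_{k\ell}=p^*\le1-\varepsilon$ and $\max_{k,\ell}P_{k\ell}\big/\min_{k,\ell}P_{k\ell}\le\omega$; * $\min_{k\neq\ell}\max_{r\in[K]}\max\Big(\frac{P_{kr}}{P_{\ell r}},\frac{P_{\ell r}}{P_{kr}}\Big)\ge\omega'$; * $D\Big(\bigotimes_{j=1}^n\mathrm{Bern}(P_{kz_j})\,\Big\|\,\bigotimes_{j=1}^n\mathrm{Bern}(P_{\ell z_j})\Big)\ge D^*$ for all $k\neq\ell$. **Theorem (minimax lower bound).** There are constants $C,c>0$ depending only on $\beta,\varepsilon,K^*,\omega,\omega'$ such that the following holds for all integers $n$ and $K$ with $3\le K\le K^*$, all $p^*\in(0,1)$ and all $D^*\in\mathbb R$. If $np^*\ge C$, and if there is $q$ with $0<q<p^*\le1-\varepsilon$, $\omega'\le p^*/q\le\omega$ and $$D^*=D\big(\mathrm{Bin}(\lfloor n/K\rfloor,p^*)\,\big\|\,\mathrm{Bin}(\lfloor n/K\rfloor,q)\big),$$ then $$\inf_{\hat z}\ \sup_{(z,P)\in\mathcal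 S(n,p^*,K,D^*)}\mathbb E_{A\sim\mathrm{SBM}(z,P)}\big[\mathrm{mis}(\hat z,z)\big]\ \ge\ \frac{c}{\sqrt{np^*}}\,e^{-D^*},$$ where the infimum is over all estimators $\hat z$. -/

import Mathlib

open MeasureTheory ProbabilityTheory

/-! Vectors of labels are functions `Fin n → Fin K`; adjacency matrices with entries in `{0, 1}` are
functions `Fin n → Fin n → Bool` (with `true` for `1`). -/

section Chernoff

/-- Chernoff `α`-divergence `-log ∑ₓ φ₀(x)^(1-α) φ₁(x)^α` of two laws on a countable space, where
`φ₀`, `φ₁` are their probability mass functions. -/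
noncomputable def chernoffDiv {X : Type*} [MeasurableSpace X] (α : ℝ) (μ ν : Measure X) : ℝ :=
  -Real.log (∑' x, (μ.real {x}) ^ (1 - α) * (ν.real {x}) ^ α)

/-- Chernoff information: the largest Chernoff `α`-divergence over `α ∈ (0, 1)`. -/
noncomputable def chernoffInfo {X : Type*} [MeasurableSpace X] (μ ν : Measure X) : ℝ :=
  ⨆ α : Set.Ioo (0 : ℝ) 1, chernoffDiv (α : ℝ) μ ν

end Chernoff

namespace SBM

/-- The product law `⨂ⱼ Bern(p j)` on `{0, 1}ⁿ`. -/
noncomputable def bernoulliVector {n : ℕ} (p : Fin n → unitInterval) : Measure (Fin n → Bool) :=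
  Measure.pi fun j => bernoulliMeasure true false (p j)

/-- The pairs `(i, j)` with `i > j`. -/
abbrev LowerPairs (n : ℕ) : Type := {e : Fin n × Fin n // e.2 < e.1}

/-- The symmetric matrix with zero diagonal that has the given entries below the diagonal. -/
def symmMatrix {n : ℕ} (x : LowerPairs n → Bool) : Fin n → Fin n → Bool := fun i j =>
  if h : j < i then x ⟨(i, j), h⟩ else if h : i < j then x ⟨(j, i), h⟩ else false

/-- The law of the adjacency matrix of the stochastic block model with labels `z` and connectivity
matrix `P`: the entries `A i j = A j i ∼ Bern(P (z i) (z j))`, `i > j`, are independent, and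
`A i i = 0`. -/
noncomputable def law {n K : ℕ} (z : Fin n → Fin K) (P : Matrix (Fin K) (Fin K) unitInterval) :
    Measure (Fin n → Fin n → Bool) :=
  (Measure.pi fun e : LowerPairs n =>
    bernoulliMeasure true false (P (z e.1.1) (z e.1.2))).map symmMatrix

/-- The misclassification rate of the estimate `y` of `z`: the proportion of wrong labels,
minimized over all relabellings of the communities. -/
noncomputable def mis {n K : ℕ} (y z : Fin n → Fin K) : ℝ :=
  ⨅ π : Equiv.Perm (Fin K), (1 / (n : ℝ)) * ∑ i, if π (y i) ≠ z i then (1 : ℝ) else 0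

/-- A (possibly randomized) estimator of the labels: given the adjacency matrix it returns a
random label vector. The non-randomized estimators are those of the form
`fun A => PMF.pure (f A)`. -/
abbrev Estimator (n K : ℕ) : Type := (Fin n → Fin n → Bool) → PMF (Fin n → Fin K)

/-- The expected misclassification rate of the estimator `zhat` in the model `θ = (z, P)`. -/
noncomputable def risk {n K : ℕ} (zhat : Estimator n K)
    (θ : (Fin n → Fin K) × Matrix (Fin K) (Fin K) unitInterval) : ℝ :=
  ∫ A, ∑ y, (zhat A y).toReal * mis y θ.1 ∂(law θ.1 θ.2)

/-- The minimax risk over a class `S` of models. All risks lie in `[0, 1]`, so that the suprema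
and the infimum of real numbers are genuine ones. -/
noncomputable def minimaxRisk {n K : ℕ}
    (S : Set ((Fin n → Fin K) × Matrix (Fin K) (Fin K) unitInterval)) : ℝ :=
  ⨅ zhat : Estimator n K, ⨆ θ : S, risk zhat θ

/-- The size of community `k`. -/
def communitySize {n K : ℕ} (z : Fin n → Fin K) (k : Fin K) : ℕ :=
  (Finset.univ.filter fun i => z i = k).card

/-- The parameter space `𝒮(n, p*, K, D*)` (with the constants `β, ε, ω, ω'`), as a predicate on
`(z, P)`. -/
structure Admissible (β ε ω ω' : ℝ) {n K : ℕ} (pstar : unitInterval) (Dstar : ℝ)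
    (z : Fin n → Fin K) (P : Matrix (Fin K) (Fin K) unitInterval) : Prop where
  pos : ∀ k l, 0 < (P k l : ℝ)
  lt_one : ∀ k l, (P k l : ℝ) < 1
  symm : P.IsSymm
  balanced : ∀ k, (n : ℝ) / (β * K) ≤ communitySize z k ∧ (communitySize z k : ℝ) ≤ β * n / K
  max_eq : (∀ k l, P k l ≤ pstar) ∧ ∃ k l, P k l = pstar
  max_le : (pstar : ℝ) ≤ 1 - ε
  ratio_le : ∀ k l k' l', (P k l : ℝ) / P k' l' ≤ ω
  separated : ∀ k l, k ≠ l →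
    ∃ r, ω' ≤ max ((P k r : ℝ) / P l r) ((P l r : ℝ) / P k r)
  chernoff : ∀ k l, k ≠ l →
    Dstar ≤ chernoffInfo (bernoulliVector fun j => P k (z j)) (bernoulliVector fun j => P l (z j))

/-- The parameter space `𝒮(n, p*, K, D*)`. -/
def paramSpace (β ε ω ω' : ℝ) (n : ℕ) (pstar : unitInterval) (K : ℕ) (Dstar : ℝ) :
    Set ((Fin n → Fin K) × Matrix (Fin K) (Fin K) unitInterval) :=
  {θ | Admissible β ε ω ω' pstar Dstar θ.1 θ.2}

end SBM

/-!
Let row `k` of `P` have its entries `p` in the last `k` columns and `q` elsewhere. Any two rows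
then differ on a whole community, so all their Chernoff informations are at least
`D(Bin(m, p) ‖ Bin(m, q))`, `m = ⌊n / K⌋`, while the rows `0` and `1` differ in the last column
only. Let the labels of `s ≍ n` vertices of the first block vary in `{0, 1}`. All resulting
labellings agree on most of each community, so an estimate that is close to one of them determines
how the communities are matched, the misclassification rate is a sum over vertices, and flipping
the label of one vertex changes the law only in its `m` edges to the last block: an error at that
vertex costs at least the testing error of `Bin(m, p)` against `Bin(m, q)` (Assouad's argument).

For this test, `φ₀^(1-α) φ₁^α` is `e^(-m d_α)` times a binomial mass function, with `d_α` the
Chernoff divergence of the Bernoulli laws. By Rolle's theorem there is an `α` at which the two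
likelihoods agree at the mean of the tilted binomial. There the tilted mass is of order
`1 / √(m p)` by Stirling's formula, so that `min(φ₀, φ₁)` is at least of order `e^(-D*) / √(m p)`.
-/

section BinomialMode

theorem factorial_le_exp_mul_sqrt_mul_pow {n : ℕ} (hn : n ≠ 0) :
    (n.factorial : ℝ) ≤ Real.exp 1 * √n * (n / Real.exp 1) ^ n := by
  obtain ⟨k, rfl⟩ := Nat.exists_eq_succ_of_ne_zero hn
  have h := Stirling.stirlingSeq'_antitone (Nat.zero_le k)
  simp only [Function.comp_apply, Nat.succ_eq_add_one, zero_add, Stirling.stirlingSeq_one] at h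
  rw [Stirling.stirlingSeq, div_le_iff₀ (by positivity)] at h
  refine h.trans_eq ?_
  rw [Real.sqrt_mul zero_le_two]
  field_simp

theorem exp_neg_two_div_sqrt_mul_pow_le_choose_mul {k l : ℕ} (hk : k ≠ 0) (hl : l ≠ 0) :
    Real.exp (-2) / √k * (k + l : ℝ) ^ (k + l) ≤
      (k + l).choose k * ((k : ℝ) ^ k * (l : ℝ) ^ l) := by
  set e := Real.exp 1 with he
  have he0 : 0 < e := Real.exp_pos 1
  have hexp : Real.exp (-2) = 1 / e ^ 2 := by
    rw [he, ← Real.exp_nat_mul, one_div, ← Real.exp_neg]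
    norm_num
  have hl0 : 0 < √(l : ℝ) := by positivity
  have hfactorial : ((k + l).choose k : ℝ) * k.factorial * l.factorial = (k + l).factorial := by
    rw [Nat.choose_symm_add]
    exact_mod_cast Nat.add_choose_mul_factorial_mul_factorial k l
  have hsqrt : √(l : ℝ) ≤ √(2 * Real.pi * (k + l : ℕ)) := by
    refine Real.sqrt_le_sqrt ?_
    push_cast
    nlinarith [Real.pi_gt_three]
  have hstirling : √(l : ℝ) * ((k + l : ℝ) ^ (k + l) / e ^ (k + l)) ≤
      (k + l).choose k * (e * √k * ((k : ℝ) ^ k / e ^ k)) * (e * √l * ((l : ℝ) ^ l / e ^ l)) := by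
    calc √(l : ℝ) * ((k + l : ℝ) ^ (k + l) / e ^ (k + l))
        ≤ √(2 * Real.pi * (k + l : ℕ)) * (((k + l : ℕ) : ℝ) / e) ^ (k + l) := by
          rw [← div_pow, ← Nat.cast_add]
          gcongr
      _ ≤ (k + l).choose k * k.factorial * l.factorial := by
          rw [hfactorial]
          exact Stirling.le_factorial_stirling _
      _ ≤ _ := by
          simp only [← div_pow]
          gcongr
          · exact factorial_le_exp_mul_sqrt_mul_pow hk
          · exact factorial_le_exp_mul_sqrt_mul_pow hl
  rw [hexp, div_div, div_mul_eq_mul_div, one_mul, div_le_iff₀ (by positivity)]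
  rw [pow_add e] at hstirling
  field_simp at hstirling
  linarith

theorem exp_neg_two_mul_pow_le_pred_pow {l : ℕ} (hl : 2 ≤ l) :
    Real.exp (-2) * (l : ℝ) ^ l ≤ (l - 1 : ℝ) ^ l := by
  have hl' : (2 : ℝ) ≤ l := by exact_mod_cast hl
  have hbase : Real.exp (-(2 / l)) * l ≤ l - 1 := by
    rw [Real.exp_neg, inv_mul_le_iff₀ (Real.exp_pos _)]
    have hle : (2 : ℝ) / l ≤ 1 := (div_le_one (by linarith)).2 hl'
    calc (l : ℝ) ≤ l + (1 - 2 / l) := by linarith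
      _ = (2 / l + 1) * (l - 1) := by field_simp; ring
      _ ≤ Real.exp (2 / l) * (l - 1) := by
          gcongr
          · linarith
          · exact Real.add_one_le_exp _
  calc Real.exp (-2) * (l : ℝ) ^ l = (Real.exp (-(2 / l)) * l) ^ l := by
        rw [mul_pow, ← Real.exp_nat_mul]
        congr 2
        field_simp
    _ ≤ _ := pow_le_pow_left₀ (by positivity) hbase l

theorem exp_neg_four_div_sqrt_le_choose_mul {k l : ℕ} {r : ℝ} (hk : 1 ≤ k) (hl : 2 ≤ l)
    (hkr : (k : ℝ) ≤ (k + l) * r) (hrk : (k + l) * r ≤ k + 1) :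
    Real.exp (-4) / √((k + l) * r) ≤ (k + l).choose k * (r ^ k * (1 - r) ^ l) := by
  have hk' : (1 : ℝ) ≤ k := by exact_mod_cast hk
  have hl' : (2 : ℝ) ≤ l := by exact_mod_cast hl
  have hkl : (0 : ℝ) < k + l := by linarith
  have hmean : 0 ≤ (k + l) * r := by linarith
  have hsuccesses : (k : ℝ) ^ k ≤ ((k + l) * r) ^ k := pow_le_pow_left₀ (by linarith) hkr k
  have hfailures : Real.exp (-2) * (l : ℝ) ^ l ≤ ((k + l) * (1 - r)) ^ l :=
    (exp_neg_two_mul_pow_le_pred_pow hl).trans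
      (pow_le_pow_left₀ (by linarith) (by linarith) l)
  have hexp : Real.exp (-4) = Real.exp (-2) * Real.exp (-2) := by
    rw [← Real.exp_add]
    norm_num
  refine le_of_mul_le_mul_right ?_ (pow_pos hkl (k + l))
  calc Real.exp (-4) / √((k + l) * r) * (k + l : ℝ) ^ (k + l)
      ≤ Real.exp (-4) / √k * (k + l : ℝ) ^ (k + l) := by gcongr
    _ = Real.exp (-2) * (Real.exp (-2) / √k * (k + l : ℝ) ^ (k + l)) := by rw [hexp]; ring
    _ ≤ Real.exp (-2) * ((k + l).choose k * ((k : ℝ) ^ k * (l : ℝ) ^ l)) := by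
        exact mul_le_mul_of_nonneg_left (exp_neg_two_div_sqrt_mul_pow_le_choose_mul
          (Nat.one_le_iff_ne_zero.1 hk) (Nat.zero_lt_two.trans_le hl).ne') (Real.exp_pos _).le
    _ = (k + l).choose k * ((k : ℝ) ^ k * (Real.exp (-2) * (l : ℝ) ^ l)) := by ring
    _ ≤ (k + l).choose k * (((k + l) * r) ^ k * ((k + l) * (1 - r)) ^ l) := by gcongr
    _ = _ := by rw [mul_pow, mul_pow, pow_add]; ring

end BinomialMode

section BernoulliTilt

/-- The Chernoff affinity `∑ₓ φ₀(x)^(1-α) φ₁(x)^α` of the laws `Bern(p)` and `Bern(q)`. -/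
noncomputable def bernoulliAffinity (α p q : ℝ) : ℝ :=
  p ^ (1 - α) * q ^ α + (1 - p) ^ (1 - α) * (1 - q) ^ α

/-- The success probability of the Bernoulli law whose mass function is proportional to
`φ₀^(1-α) φ₁^α`, where `φ₀` and `φ₁` are the mass functions of `Bern(p)` and `Bern(q)`. -/
noncomputable def bernoulliTilt (α p q : ℝ) : ℝ :=
  p ^ (1 - α) * q ^ α / bernoulliAffinity α p q

variable {α p q : ℝ}

theorem bernoulliAffinity_pos (hp : p ∈ Set.Ioo 0 1) (hq : q ∈ Set.Ioo 0 1) :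
    0 < bernoulliAffinity α p q :=
  add_pos (mul_pos (Real.rpow_pos_of_pos hp.1 _) (Real.rpow_pos_of_pos hq.1 _))
    (mul_pos (Real.rpow_pos_of_pos (sub_pos.2 hp.2) _) (Real.rpow_pos_of_pos (sub_pos.2 hq.2) _))

theorem bernoulliTilt_mul_bernoulliAffinity (hp : p ∈ Set.Ioo 0 1) (hq : q ∈ Set.Ioo 0 1) :
    bernoulliTilt α p q * bernoulliAffinity α p q = p ^ (1 - α) * q ^ α :=
  div_mul_cancel₀ _ (bernoulliAffinity_pos hp hq).ne'

theorem one_sub_bernoulliTilt_mul_bernoulliAffinity (hp : p ∈ Set.Ioo 0 1)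
    (hq : q ∈ Set.Ioo 0 1) :
    (1 - bernoulliTilt α p q) * bernoulliAffinity α p q = (1 - p) ^ (1 - α) * (1 - q) ^ α := by
  rw [sub_mul, one_mul, bernoulliTilt_mul_bernoulliAffinity hp hq, bernoulliAffinity,
    add_sub_cancel_left]

theorem bernoulliAffinity_pow_mul_bernoulliTilt (hp : p ∈ Set.Ioo 0 1) (hq : q ∈ Set.Ioo 0 1)
    (k l : ℕ) :
    bernoulliAffinity α p q ^ (k + l) *
        (bernoulliTilt α p q ^ k * (1 - bernoulliTilt α p q) ^ l) =
      (p ^ k * (1 - p) ^ l) ^ (1 - α) * (q ^ k * (1 - q) ^ l) ^ α := by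
  have h1p := (sub_pos.2 hp.2).le
  have h1q := (sub_pos.2 hq.2).le
  calc _ = (bernoulliTilt α p q * bernoulliAffinity α p q) ^ k *
        ((1 - bernoulliTilt α p q) * bernoulliAffinity α p q) ^ l := by
        rw [mul_pow, mul_pow, pow_add]
        ring
    _ = (p ^ (1 - α) * q ^ α) ^ k * ((1 - p) ^ (1 - α) * (1 - q) ^ α) ^ l := by
        rw [bernoulliTilt_mul_bernoulliAffinity hp hq,
          one_sub_bernoulliTilt_mul_bernoulliAffinity hp hq]
    _ = _ := by
        rw [Real.mul_rpow (pow_nonneg hp.1.le k) (pow_nonneg h1p l),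
          Real.mul_rpow (pow_nonneg hq.1.le k) (pow_nonneg h1q l), ← Real.rpow_pow_comm hp.1.le,
          ← Real.rpow_pow_comm hq.1.le, ← Real.rpow_pow_comm h1p, ← Real.rpow_pow_comm h1q,
          mul_pow, mul_pow]
        ring

theorem rpow_one_sub_mul_rpow_self {x : ℝ} (hx : 0 < x) (α : ℝ) : x ^ (1 - α) * x ^ α = x := by
  rw [← Real.rpow_add hx, sub_add_cancel, Real.rpow_one]

theorem le_bernoulliTilt (hα : α ≤ 1) (hq : 0 < q) (hqp : q ≤ p) (hp : p < 1) :
    q ≤ bernoulliTilt α p q := by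
  have hp0 := hq.trans_le hqp
  have h1p := sub_pos.2 hp
  have h1q : 0 < 1 - q := by linarith
  have hodds : q * ((1 - p) ^ (1 - α) * (1 - q) ^ α) ≤ (1 - q) * (p ^ (1 - α) * q ^ α) :=
    calc q * ((1 - p) ^ (1 - α) * (1 - q) ^ α)
        = (q ^ (1 - α) * q ^ α) * ((1 - p) ^ (1 - α) * (1 - q) ^ α) := by
          rw [rpow_one_sub_mul_rpow_self hq]
      _ = (q * (1 - p)) ^ (1 - α) * (q ^ α * (1 - q) ^ α) := by
          rw [Real.mul_rpow hq.le h1p.le]; ring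
      _ ≤ (p * (1 - q)) ^ (1 - α) * (q ^ α * (1 - q) ^ α) := by
          gcongr
      _ = ((1 - q) ^ (1 - α) * (1 - q) ^ α) * (p ^ (1 - α) * q ^ α) := by
          rw [Real.mul_rpow hp0.le h1q.le]; ring
      _ = (1 - q) * (p ^ (1 - α) * q ^ α) := by rw [rpow_one_sub_mul_rpow_self h1q]
  rw [bernoulliTilt, le_div_iff₀ (bernoulliAffinity_pos ⟨hp0, hp⟩ ⟨hq, hqp.trans_lt hp⟩),
    bernoulliAffinity]
  linarith

theorem one_sub_bernoulliTilt (hp : p ∈ Set.Ioo 0 1) (hq : q ∈ Set.Ioo 0 1) :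
    1 - bernoulliTilt α p q = bernoulliTilt (1 - α) (1 - q) (1 - p) := by
  rw [eq_div_of_mul_eq (bernoulliAffinity_pos hp hq).ne'
    (one_sub_bernoulliTilt_mul_bernoulliAffinity hp hq), bernoulliTilt, bernoulliAffinity,
    bernoulliAffinity]
  ring_nf

theorem bernoulliTilt_le (hα : 0 ≤ α) (hq : 0 < q) (hqp : q ≤ p) (hp : p < 1) :
    bernoulliTilt α p q ≤ p := by
  have h := le_bernoulliTilt (α := 1 - α) (p := 1 - q) (q := 1 - p)
    (by linarith) (by linarith) (by linarith) (by linarith)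
  rw [← one_sub_bernoulliTilt ⟨hq.trans_le hqp, hp⟩ ⟨hq, hqp.trans_lt hp⟩] at h
  linarith

theorem hasDerivAt_rpow_one_sub_mul_rpow {x y : ℝ} (hx : 0 < x) (hy : 0 < y) (α : ℝ) :
    HasDerivAt (fun a : ℝ => x ^ (1 - a) * y ^ a)
      (x ^ (1 - α) * y ^ α * (Real.log y - Real.log x)) α := by
  have hxα := ((hasDerivAt_id α).const_sub 1).const_rpow hx
  have hyα := (hasDerivAt_id α).const_rpow hy
  refine (hxα.mul hyα).congr_deriv ?_
  simp only [id_eq]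
  ring

/-- Rolle's theorem applies because the affinity is `1` at both `α = 0` and `α = 1`. -/
theorem exists_bernoulliTilt_balanced (hp : p ∈ Set.Ioo 0 1) (hq : q ∈ Set.Ioo 0 1) :
    ∃ α ∈ Set.Ioo (0 : ℝ) 1,
      bernoulliTilt α p q * (Real.log q - Real.log p) +
        (1 - bernoulliTilt α p q) * (Real.log (1 - q) - Real.log (1 - p)) = 0 := by
  have hderiv : ∀ α, HasDerivAt (fun a => bernoulliAffinity a p q)
      (p ^ (1 - α) * q ^ α * (Real.log q - Real.log p) +
        (1 - p) ^ (1 - α) * (1 - q) ^ α * (Real.log (1 - q) - Real.log (1 - p))) α := fun α =>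
    (hasDerivAt_rpow_one_sub_mul_rpow hp.1 hq.1 α).add
      (hasDerivAt_rpow_one_sub_mul_rpow (sub_pos.2 hp.2) (sub_pos.2 hq.2) α)
  obtain ⟨α, hα, h⟩ := exists_hasDerivAt_eq_zero (zero_lt_one' ℝ)
    (fun α _ => (hderiv α).continuousAt.continuousWithinAt) (by simp [bernoulliAffinity])
    fun α _ => hderiv α
  refine ⟨α, hα, (mul_eq_zero.1 ?_).resolve_left (bernoulliAffinity_pos (α := α) hp hq).ne'⟩
  rw [← h, ← bernoulliTilt_mul_bernoulliAffinity hp hq,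
    ← one_sub_bernoulliTilt_mul_bernoulliAffinity hp hq]
  ring

theorem log_bernoulli_likelihood {x : ℝ} (hx : x ∈ Set.Ioo 0 1) (k l : ℕ) :
    Real.log (x ^ k * (1 - x) ^ l) = k * Real.log x + l * Real.log (1 - x) := by
  rw [Real.log_mul (pow_pos hx.1 k).ne' (pow_pos (sub_pos.2 hx.2) l).ne', Real.log_pow,
    Real.log_pow]

theorem log_likelihood_sub_of_balanced {r : ℝ} (hp : p ∈ Set.Ioo 0 1) (hq : q ∈ Set.Ioo 0 1)
    (hr : r * (Real.log q - Real.log p) + (1 - r) * (Real.log (1 - q) - Real.log (1 - p)) = 0)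
    (k l : ℕ) :
    Real.log (q ^ k * (1 - q) ^ l) - Real.log (p ^ k * (1 - p) ^ l) =
      ((k + l) * r - k) * Real.log (p * (1 - q) / (q * (1 - p))) := by
  rw [log_bernoulli_likelihood hp, log_bernoulli_likelihood hq,
    Real.log_div (mul_pos hp.1 (sub_pos.2 hq.2)).ne' (mul_pos hq.1 (sub_pos.2 hp.2)).ne',
    Real.log_mul hp.1.ne' (sub_pos.2 hq.2).ne', Real.log_mul hq.1.ne' (sub_pos.2 hp.2).ne']
  linear_combination (k + l) * hr

theorem one_le_oddsRatio (hq : 0 < q) (hqp : q ≤ p) (hp : p < 1) :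
    1 ≤ p * (1 - q) / (q * (1 - p)) := by
  rw [one_le_div (mul_pos hq (sub_pos.2 hp))]
  linarith

theorem rpow_mul_rpow_likelihood_le_mul_min {r : ℝ} {k l : ℕ} (hα : α ≤ 1) (hq : 0 < q)
    (hqp : q ≤ p) (hp : p < 1)
    (hr : r * (Real.log q - Real.log p) + (1 - r) * (Real.log (1 - q) - Real.log (1 - p)) = 0)
    (hkr : (k : ℝ) ≤ (k + l) * r) (hrk : (k + l) * r ≤ k + 1) :
    (p ^ k * (1 - p) ^ l) ^ (1 - α) * (q ^ k * (1 - q) ^ l) ^ α ≤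
      p * (1 - q) / (q * (1 - p)) * min (p ^ k * (1 - p) ^ l) (q ^ k * (1 - q) ^ l) := by
  have hp' : p ∈ Set.Ioo 0 1 := ⟨hq.trans_le hqp, hp⟩
  have hq' : q ∈ Set.Ioo 0 1 := ⟨hq, hqp.trans_lt hp⟩
  have hLp : 0 < p ^ k * (1 - p) ^ l := mul_pos (pow_pos hp'.1 k) (pow_pos (sub_pos.2 hp) l)
  have hLq : 0 < q ^ k * (1 - q) ^ l := mul_pos (pow_pos hq k) (pow_pos (sub_pos.2 hq'.2) l)
  have hodds := one_le_oddsRatio hq hqp hp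
  have hlog := log_likelihood_sub_of_balanced hp' hq' hr k l
  have hLpq : p ^ k * (1 - p) ^ l ≤ q ^ k * (1 - q) ^ l := by
    rw [← Real.log_le_log_iff hLp hLq, ← sub_nonneg, hlog]
    exact mul_nonneg (sub_nonneg.2 hkr) (Real.log_nonneg hodds)
  have hLqp : q ^ k * (1 - q) ^ l ≤ p * (1 - q) / (q * (1 - p)) * (p ^ k * (1 - p) ^ l) := by
    rw [← Real.log_le_log_iff hLq (by positivity), Real.log_mul (by positivity) hLp.ne',
      ← sub_le_iff_le_add, hlog]
    exact mul_le_of_le_one_left (Real.log_nonneg hodds) (by linarith)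
  rw [min_eq_left hLpq]
  refine le_trans ?_ hLqp
  calc (p ^ k * (1 - p) ^ l) ^ (1 - α) * (q ^ k * (1 - q) ^ l) ^ α
      ≤ (q ^ k * (1 - q) ^ l) ^ (1 - α) * (q ^ k * (1 - q) ^ l) ^ α := by gcongr
    _ = _ := rpow_one_sub_mul_rpow_self hLq α

theorem bernoulliAffinity_pow_le_choose_mul_min {k l : ℕ} (hα : α ∈ Set.Icc 0 1) (hq : 0 < q)
    (hqp : q ≤ p) (hp : p < 1)
    (hbalanced : bernoulliTilt α p q * (Real.log q - Real.log p) +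
      (1 - bernoulliTilt α p q) * (Real.log (1 - q) - Real.log (1 - p)) = 0)
    (hk : 1 ≤ k) (hl : 2 ≤ l) (hkr : (k : ℝ) ≤ (k + l) * bernoulliTilt α p q)
    (hrk : (k + l) * bernoulliTilt α p q ≤ k + 1) :
    Real.exp (-4) / √((k + l) * p) * bernoulliAffinity α p q ^ (k + l) ≤
      p * (1 - q) / (q * (1 - p)) *
        ((k + l).choose k * min (p ^ k * (1 - p) ^ l) (q ^ k * (1 - q) ^ l)) := by
  have hp' : p ∈ Set.Ioo 0 1 := ⟨hq.trans_le hqp, hp⟩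
  have hq' : q ∈ Set.Ioo 0 1 := ⟨hq, hqp.trans_lt hp⟩
  have hr0 : 0 < bernoulliTilt α p q := hq.trans_le (le_bernoulliTilt hα.2 hq hqp hp)
  have hrp : bernoulliTilt α p q ≤ p := bernoulliTilt_le hα.1 hq hqp hp
  have haff : 0 < bernoulliAffinity α p q := bernoulliAffinity_pos hp' hq'
  set r := bernoulliTilt α p q
  calc Real.exp (-4) / √((k + l) * p) * bernoulliAffinity α p q ^ (k + l)
      ≤ Real.exp (-4) / √((k + l) * r) * bernoulliAffinity α p q ^ (k + l) := by gcongr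
    _ ≤ (k + l).choose k * (r ^ k * (1 - r) ^ l) * bernoulliAffinity α p q ^ (k + l) := by
        gcongr
        exact exp_neg_four_div_sqrt_le_choose_mul hk hl hkr hrk
    _ = (k + l).choose k * ((p ^ k * (1 - p) ^ l) ^ (1 - α) * (q ^ k * (1 - q) ^ l) ^ α) := by
        rw [← bernoulliAffinity_pow_mul_bernoulliTilt hp' hq']
        ring
    _ ≤ (k + l).choose k * (p * (1 - q) / (q * (1 - p)) *
          min (p ^ k * (1 - p) ^ l) (q ^ k * (1 - q) ^ l)) := by
        exact mul_le_mul_of_nonneg_left (rpow_mul_rpow_likelihood_le_mul_min hα.2 hq hqp hp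
          hbalanced hkr hrk) (Nat.cast_nonneg _)
    _ = _ := by ring

theorem exists_bernoulliAffinity_pow_le_choose_mul_min {m : ℕ} (hq : 0 < q) (hqp : q ≤ p)
    (hp : p < 1) (hmq : 1 ≤ m * q) (hmp : 2 ≤ m * (1 - p)) :
    ∃ α ∈ Set.Ioo (0 : ℝ) 1, ∃ k l : ℕ, k + l = m ∧
      Real.exp (-4) / √(m * p) * bernoulliAffinity α p q ^ m ≤
        p * (1 - q) / (q * (1 - p)) *
          (m.choose k * min (p ^ k * (1 - p) ^ l) (q ^ k * (1 - q) ^ l)) := by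
  obtain ⟨α, hα, hbalanced⟩ :=
    exists_bernoulliTilt_balanced ⟨hq.trans_le hqp, hp⟩ ⟨hq, hqp.trans_lt hp⟩
  have hmqr : m * q ≤ m * bernoulliTilt α p q :=
    mul_le_mul_of_nonneg_left (le_bernoulliTilt hα.2.le hq hqp hp) m.cast_nonneg
  have hmrp : m * bernoulliTilt α p q ≤ m * p :=
    mul_le_mul_of_nonneg_left (bernoulliTilt_le hα.1.le hq hqp hp) m.cast_nonneg
  have hkr : (⌊m * bernoulliTilt α p q⌋₊ : ℝ) ≤ m * bernoulliTilt α p q :=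
    Nat.floor_le (by linarith)
  have hrk := (Nat.lt_floor_add_one (m * bernoulliTilt α p q)).le
  have hk : 1 ≤ ⌊m * bernoulliTilt α p q⌋₊ := Nat.le_floor (by push_cast; linarith)
  obtain ⟨l, hl⟩ : ∃ l, m = ⌊m * bernoulliTilt α p q⌋₊ + l :=
    Nat.exists_eq_add_of_le (by
      exact_mod_cast (by linarith : (⌊m * bernoulliTilt α p q⌋₊ : ℝ) ≤ m))
  generalize ⌊m * bernoulliTilt α p q⌋₊ = k at *
  subst hl
  push_cast at *
  have hl2 : 2 ≤ l := by exact_mod_cast (by linarith : (2 : ℝ) ≤ l)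
  exact ⟨α, hα, k, l, rfl, bernoulliAffinity_pow_le_choose_mul_min (Set.Ioo_subset_Icc_self hα)
    hq hqp hp hbalanced hk hl2 hkr hrk⟩

end BernoulliTilt

section Affinity

variable {α p q : ℝ}

theorem one_sub_mul_one_sub_le_bernoulliAffinity (hα : α ∈ Set.Icc 0 1) (hp : p ∈ Set.Icc 0 1)
    (hq : q ∈ Set.Icc 0 1) : (1 - p) * (1 - q) ≤ bernoulliAffinity α p q :=
  calc (1 - p) * (1 - q) ≤ (1 - p) ^ (1 - α) * (1 - q) ^ α :=
        mul_le_mul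
          (Real.self_le_rpow_of_le_one (sub_nonneg.2 hp.2) (sub_le_self 1 hp.1)
            (sub_le_self 1 hα.1))
          (Real.self_le_rpow_of_le_one (sub_nonneg.2 hq.2) (sub_le_self 1 hq.1) hα.2)
          (sub_nonneg.2 hq.2) (Real.rpow_nonneg (sub_nonneg.2 hp.2) _)
    _ ≤ bernoulliAffinity α p q :=
        le_add_of_nonneg_left (mul_nonneg (Real.rpow_nonneg hp.1 _) (Real.rpow_nonneg hq.1 _))

theorem bernoulliAffinity_nonneg (hα : α ∈ Set.Icc 0 1) (hp : p ∈ Set.Icc 0 1)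
    (hq : q ∈ Set.Icc 0 1) : 0 ≤ bernoulliAffinity α p q :=
  (mul_nonneg (sub_nonneg.2 hp.2) (sub_nonneg.2 hq.2)).trans
    (one_sub_mul_one_sub_le_bernoulliAffinity hα hp hq)

theorem bernoulliAffinity_le_one (hα : α ∈ Set.Icc 0 1) (hp : p ∈ Set.Icc 0 1)
    (hq : q ∈ Set.Icc 0 1) : bernoulliAffinity α p q ≤ 1 := by
  have hα' : 0 ≤ 1 - α := sub_nonneg.2 hα.2
  have hsuccess := Real.geom_mean_le_arith_mean2_weighted hα' hα.1 hp.1 hq.1 (by ring)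
  have hfailure := Real.geom_mean_le_arith_mean2_weighted hα' hα.1 (sub_nonneg.2 hp.2)
    (sub_nonneg.2 hq.2) (by ring)
  rw [bernoulliAffinity]
  linarith

end Affinity

section ChernoffInformation

theorem chernoffInfo_comm {X : Type*} [MeasurableSpace X] (μ ν : Measure X) :
    chernoffInfo μ ν = chernoffInfo ν μ := by
  have hmem (α : Set.Ioo (0 : ℝ) 1) : 1 - (α : ℝ) ∈ Set.Ioo (0 : ℝ) 1 :=
    ⟨sub_pos.2 α.2.2, sub_lt_self 1 α.2.1⟩
  refine Function.Surjective.iSup_congr (fun α => ⟨1 - α, hmem α⟩)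
    (fun α => ⟨⟨1 - α, hmem α⟩, Subtype.ext (sub_sub_cancel 1 (α : ℝ))⟩) fun α => ?_
  simp only [chernoffDiv, sub_sub_cancel, mul_comm]

theorem chernoffDiv_binomial (α : ℝ) (m : ℕ) (p q : unitInterval) :
    chernoffDiv α (binomial m p) (binomial m q) = -Real.log (bernoulliAffinity α p q ^ m) := by
  have hp := sub_nonneg.2 p.2.2
  have hq := sub_nonneg.2 q.2.2
  rw [chernoffDiv, bernoulliAffinity, add_pow, tsum_eq_sum (s := Finset.range (m + 1))]
  · congr 2
    refine Finset.sum_congr rfl fun k hk => ?_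
    have hchoose : 0 < (m.choose k : ℝ) :=
      Nat.cast_pos.2 (Nat.choose_pos (Nat.lt_succ_iff.1 (Finset.mem_range.1 hk)))
    rw [binomial_real_singleton, binomial_real_singleton]
    calc _ = (m.choose k : ℝ) ^ (1 - α) * (m.choose k : ℝ) ^ α *
          ((p ^ k : ℝ) ^ (1 - α) * (q ^ k : ℝ) ^ α *
            (((1 - p) ^ (m - k) : ℝ) ^ (1 - α) * ((1 - q) ^ (m - k) : ℝ) ^ α)) := by
          rw [Real.mul_rpow, Real.mul_rpow, Real.mul_rpow, Real.mul_rpow]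
          · ring
          all_goals have := p.2.1; have := q.2.1; positivity
      _ = _ := by
          rw [rpow_one_sub_mul_rpow_self hchoose, ← Real.rpow_pow_comm p.2.1,
            ← Real.rpow_pow_comm q.2.1, ← Real.rpow_pow_comm hp, ← Real.rpow_pow_comm hq,
            mul_pow, mul_pow]
          ring
  · intro k hk
    have hmk : m < k := by simpa using hk
    rw [binomial_real_singleton, binomial_real_singleton, Nat.choose_eq_zero_of_lt hmk]
    rcases eq_or_ne α 0 with rfl | hα
    · simp
    · simp [Real.zero_rpow hα]

theorem exp_neg_chernoffInfo_binomial_le {p q : unitInterval} (hp : (p : ℝ) < 1)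
    (hq : (q : ℝ) < 1) {α : ℝ} (hα : α ∈ Set.Ioo 0 1) (m : ℕ) :
    Real.exp (-chernoffInfo (binomial m p) (binomial m q)) ≤ bernoulliAffinity α p q ^ m := by
  have hc : (0 : ℝ) < (1 - p) * (1 - q) := mul_pos (sub_pos.2 hp) (sub_pos.2 hq)
  have hle {a : ℝ} (ha : a ∈ Set.Ioo 0 1) : ((1 - p) * (1 - q) : ℝ) ≤ bernoulliAffinity a p q :=
    one_sub_mul_one_sub_le_bernoulliAffinity (Set.Ioo_subset_Icc_self ha) p.2 q.2
  rw [← Real.le_log_iff_exp_le (pow_pos (hc.trans_le (hle hα)) m), neg_le, ← chernoffDiv_binomial]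
  refine le_ciSup (f := fun a : Set.Ioo (0 : ℝ) 1 =>
    chernoffDiv a (binomial m p) (binomial m q)) ⟨-Real.log (((1 - p) * (1 - q) : ℝ) ^ m), ?_⟩
    ⟨α, hα⟩
  rintro _ ⟨a, rfl⟩
  simp only [chernoffDiv_binomial, neg_le_neg_iff]
  exact Real.log_le_log (pow_pos hc m) (pow_le_pow_left₀ hc.le (hle a.2) m)

namespace SBM

/-- The law of independent Bernoulli variables with success probabilities `f e`, for an arbitrary
finite index type: the law of the entries below the diagonal of an adjacency matrix, and for
`Fin n` the law `bernoulliVector`. -/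
noncomputable def bernoulliPi {ι : Type*} [Fintype ι] (f : ι → unitInterval) :
    Measure (ι → Bool) :=
  Measure.pi fun e => bernoulliMeasure true false (f e)

instance {ι : Type*} [Fintype ι] (f : ι → unitInterval) : IsProbabilityMeasure (bernoulliPi f) := by
  unfold bernoulliPi
  infer_instance

theorem bernoulliPi_real_singleton {ι : Type*} [Fintype ι] (f : ι → unitInterval)
    (x : ι → Bool) :
    (bernoulliPi f).real {x} = ∏ e, if x e then (f e : ℝ) else 1 - f e := by
  rw [measureReal_def, bernoulliPi, Measure.pi_singleton, ENNReal.toReal_prod]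
  refine Finset.prod_congr rfl fun e _ => ?_
  rw [← measureReal_def]
  cases x e <;> simp

theorem chernoffDiv_bernoulliVector {n : ℕ} (α : ℝ) (u v : Fin n → unitInterval) :
    chernoffDiv α (bernoulliVector u) (bernoulliVector v) =
      -Real.log (∏ j, bernoulliAffinity α (u j) (v j)) := by
  have hnonneg (f : Fin n → unitInterval) (x : Fin n → Bool) (j : Fin n) :
      0 ≤ if x j then (f j : ℝ) else 1 - f j := by
    split_ifs
    exacts [(f j).2.1, sub_nonneg.2 (f j).2.2]
  have haff (j : Fin n) : bernoulliAffinity α (u j) (v j) =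
      ∑ b : Bool, (if b then (u j : ℝ) else 1 - u j) ^ (1 - α) *
        (if b then (v j : ℝ) else 1 - v j) ^ α := by
    simp [bernoulliAffinity]
  change chernoffDiv α (bernoulliPi u) (bernoulliPi v) = _
  simp only [chernoffDiv, tsum_fintype, bernoulliPi_real_singleton, haff, Fintype.prod_sum]
  congr 2
  refine Finset.sum_congr rfl fun x _ => ?_
  rw [Finset.prod_mul_distrib, Real.finsetProd_rpow _ _ fun j _ => hnonneg u x j,
    Real.finsetProd_rpow _ _ fun j _ => hnonneg v x j]

theorem bddAbove_chernoffDiv_bernoulliVector {n : ℕ} {u v : Fin n → unitInterval}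
    (hu : ∀ j, (u j : ℝ) < 1) (hv : ∀ j, (v j : ℝ) < 1) :
    BddAbove (Set.range fun α : Set.Ioo (0 : ℝ) 1 =>
      chernoffDiv (α : ℝ) (bernoulliVector u) (bernoulliVector v)) := by
  have hpos (j : Fin n) : (0 : ℝ) < (1 - u j) * (1 - v j) :=
    mul_pos (sub_pos.2 (hu j)) (sub_pos.2 (hv j))
  refine ⟨-Real.log (∏ j, ((1 - u j) * (1 - v j) : ℝ)), ?_⟩
  rintro _ ⟨α, rfl⟩
  simp only [chernoffDiv_bernoulliVector, neg_le_neg_iff]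
  exact Real.log_le_log (Finset.prod_pos fun j _ => hpos j) (Finset.prod_le_prod
    (fun j _ => (hpos j).le) fun j _ => one_sub_mul_one_sub_le_bernoulliAffinity
      (Set.Ioo_subset_Icc_self α.2) (u j).2 (v j).2)

theorem chernoffInfo_binomial_le_bernoulliVector {n m : ℕ} {p q : unitInterval}
    {u v : Fin n → unitInterval} (hu : ∀ j, (u j : ℝ) < 1) (hv : ∀ j, (v j : ℝ) < 1)
    {T : Finset (Fin n)} (hT : m ≤ T.card) (hTu : ∀ j ∈ T, u j = p) (hTv : ∀ j ∈ T, v j = q) :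
    chernoffInfo (binomial m p) (binomial m q) ≤
      chernoffInfo (bernoulliVector u) (bernoulliVector v) := by
  have : Nonempty (Set.Ioo (0 : ℝ) 1) := ⟨⟨1 / 2, by norm_num, by norm_num⟩⟩
  refine ciSup_mono (bddAbove_chernoffDiv_bernoulliVector hu hv) fun α => ?_
  have hα := Set.Ioo_subset_Icc_self α.2
  have hpos (j : Fin n) : 0 < bernoulliAffinity α (u j) (v j) :=
    (mul_pos (sub_pos.2 (hu j)) (sub_pos.2 (hv j))).trans_le
      (one_sub_mul_one_sub_le_bernoulliAffinity hα (u j).2 (v j).2)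
  rw [chernoffDiv_binomial, chernoffDiv_bernoulliVector, neg_le_neg_iff]
  refine Real.log_le_log (Finset.prod_pos fun j _ => hpos j) ?_
  calc ∏ j, bernoulliAffinity α (u j) (v j)
      ≤ ∏ j ∈ T, bernoulliAffinity α (u j) (v j) := by
        rw [← Finset.prod_mul_prod_compl T]
        exact mul_le_of_le_one_right (Finset.prod_nonneg fun j _ => (hpos j).le)
          (Finset.prod_le_one (fun j _ => (hpos j).le) fun j _ =>
            bernoulliAffinity_le_one hα (u j).2 (v j).2)
    _ = bernoulliAffinity α p q ^ T.card := by
        rw [← Finset.prod_const]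
        exact Finset.prod_congr rfl fun j hj => by rw [hTu j hj, hTv j hj]
    _ ≤ bernoulliAffinity α p q ^ m := pow_le_pow_of_le_one
        (bernoulliAffinity_nonneg hα p.2 q.2) (bernoulliAffinity_le_one hα p.2 q.2) hT

end SBM

end ChernoffInformation

section Overlap

/-- The overlap `∑ₓ min(φ₀(x), φ₁(x))` of two laws on a finite space, which is twice the optimal
Bayes error of the test between them under the uniform prior. -/
noncomputable def overlap {X : Type*} [Fintype X] [MeasurableSpace X] (μ ν : Measure X) : ℝ :=
  ∑ x, min (μ.real {x}) (ν.real {x})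

theorem overlap_comm {X : Type*} [Fintype X] [MeasurableSpace X] (μ ν : Measure X) :
    overlap μ ν = overlap ν μ := by
  simp only [overlap, min_comm]

theorem overlap_le_sum_add_sum {X : Type*} [Fintype X] [MeasurableSpace X] (μ ν : Measure X)
    {f g : X → ℝ} (hf : ∀ x, 0 ≤ f x) (hg : ∀ x, 0 ≤ g x) (hfg : ∀ x, 1 ≤ f x + g x) :
    overlap μ ν ≤ ∑ x, μ.real {x} * f x + ∑ x, ν.real {x} * g x := by
  rw [overlap, ← Finset.sum_add_distrib]
  refine Finset.sum_le_sum fun x _ => ?_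
  calc min (μ.real {x}) (ν.real {x})
      ≤ min (μ.real {x}) (ν.real {x}) * (f x + g x) :=
        le_mul_of_one_le_right (le_min measureReal_nonneg measureReal_nonneg) (hfg x)
    _ ≤ μ.real {x} * f x + ν.real {x} * g x := by
        rw [mul_add]
        exact add_le_add (mul_le_mul_of_nonneg_right (min_le_left _ _) (hf x))
          (mul_le_mul_of_nonneg_right (min_le_right _ _) (hg x))

namespace SBM

theorem overlap_bernoulliPi_restrict {ι : Type*} [Fintype ι] [DecidableEq ι]
    {f g : ι → unitInterval} {E : Finset ι} (hfg : ∀ e ∉ E, f e = g e) :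
    overlap (bernoulliPi f) (bernoulliPi g) =
      overlap (bernoulliPi fun e : {e // e ∈ E} => f e)
        (bernoulliPi fun e : {e // e ∈ E} => g e) := by
  have hsplit (h : ι → unitInterval) (x : ι → Bool) : (bernoulliPi h).real {x} =
      (bernoulliPi fun e : {e // e ∈ E} => h e).real {fun e : {e // e ∈ E} => x e} *
        (bernoulliPi fun e : {e // e ∉ E} => h e).real {fun e : {e // e ∉ E} => x e} := by
    simp only [bernoulliPi_real_singleton]
    convert (Fintype.prod_subtype_mul_prod_subtype (· ∈ E) fun e =>
      if x e then (h e : ℝ) else 1 - h e).symm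
  have hcompl : (fun e : {e // e ∉ E} => f e) = fun e : {e // e ∉ E} => g e :=
    funext fun e => hfg e e.2
  let restrict := Equiv.piEquivPiSubtypeProd (· ∈ E) fun _ => Bool
  calc overlap (bernoulliPi f) (bernoulliPi g)
      = ∑ x, min ((bernoulliPi fun e : {e // e ∈ E} => f e).real {(restrict x).1})
            ((bernoulliPi fun e : {e // e ∈ E} => g e).real {(restrict x).1}) *
          (bernoulliPi fun e : {e // e ∉ E} => g e).real {(restrict x).2} := by
        refine Finset.sum_congr rfl fun x _ => ?_
        rw [hsplit f, hsplit g, hcompl, ← min_mul_of_nonneg _ _ measureReal_nonneg]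
        rfl
    _ = _ := by
        rw [restrict.sum_comp fun y => min ((bernoulliPi fun e : {e // e ∈ E} => f e).real {y.1})
            ((bernoulliPi fun e : {e // e ∈ E} => g e).real {y.1}) *
          (bernoulliPi fun e : {e // e ∉ E} => g e).real {y.2}, Fintype.sum_prod_type]
        simp only [← Finset.mul_sum, sum_measureReal_singleton, Finset.coe_univ, probReal_univ,
          mul_one, overlap]

theorem card_filter_card_eq_true (ι : Type*) [Fintype ι] [DecidableEq ι] (k : ℕ) :
    (Finset.univ.filter fun x : ι → Bool =>
      (Finset.univ.filter fun e => x e = true).card = k).card = (Fintype.card ι).choose k := by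
  rw [← Finset.card_univ, ← Finset.card_powersetCard]
  exact Finset.card_nbij' (fun x => Finset.univ.filter fun e => x e = true)
    (fun A e => decide (e ∈ A)) (by simp [Set.MapsTo]) (by simp [Set.MapsTo])
    (by simp [Set.LeftInvOn]) (by simp [Set.LeftInvOn])

theorem bernoulliPi_const_real_singleton {ι : Type*} [Fintype ι] (p : unitInterval)
    {x : ι → Bool} {k l : ℕ} (hkl : k + l = Fintype.card ι)
    (hx : (Finset.univ.filter fun e => x e = true).card = k) :
    (bernoulliPi fun _ : ι => p).real {x} = (p : ℝ) ^ k * (1 - p) ^ l := by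
  have hl : (Finset.univ.filter fun e => ¬x e = true).card = l := by
    have := Finset.card_filter_add_card_filter_not (s := Finset.univ) fun e => x e = true
    rw [Finset.card_univ] at this
    omega
  rw [bernoulliPi_real_singleton, Finset.prod_ite, Finset.prod_const, Finset.prod_const, hx, hl]

theorem choose_mul_min_le_overlap_bernoulliPi_const {ι : Type*} [Fintype ι] [DecidableEq ι]
    (p q : unitInterval) {k l : ℕ} (hkl : k + l = Fintype.card ι) :
    (Fintype.card ι).choose k *
        min ((p : ℝ) ^ k * (1 - p) ^ l) ((q : ℝ) ^ k * (1 - q) ^ l) ≤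
      overlap (bernoulliPi fun _ : ι => p) (bernoulliPi fun _ : ι => q) := by
  rw [← card_filter_card_eq_true, ← nsmul_eq_mul, ← Finset.sum_const, overlap]
  refine (Finset.sum_le_sum fun x hx => ?_).trans
    (Finset.sum_le_sum_of_subset_of_nonneg (Finset.filter_subset _ _) fun x _ _ =>
      le_min measureReal_nonneg measureReal_nonneg)
  have hx := (Finset.mem_filter.1 hx).2
  rw [bernoulliPi_const_real_singleton p hkl hx, bernoulliPi_const_real_singleton q hkl hx]

theorem choose_mul_min_le_overlap_bernoulliPi {ι : Type*} [Fintype ι] [DecidableEq ι]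
    {f g : ι → unitInterval} {p q : unitInterval} {E : Finset ι} (hf : ∀ e ∈ E, f e = p)
    (hg : ∀ e ∈ E, g e = q) (hfg : ∀ e ∉ E, f e = g e) {k l : ℕ} (hkl : k + l = E.card) :
    E.card.choose k * min ((p : ℝ) ^ k * (1 - p) ^ l) ((q : ℝ) ^ k * (1 - q) ^ l) ≤
      overlap (bernoulliPi f) (bernoulliPi g) := by
  have hfE : (fun e : {e // e ∈ E} => f e) = fun _ => p := funext fun e => hf e e.2
  have hgE : (fun e : {e // e ∈ E} => g e) = fun _ => q := funext fun e => hg e e.2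
  have h := choose_mul_min_le_overlap_bernoulliPi_const (ι := {e // e ∈ E}) p q (k := k) (l := l)
  rw [Fintype.card_coe] at h
  rw [overlap_bernoulliPi_restrict hfg, hfE, hgE]
  exact h hkl

end SBM

end Overlap

section Assouad

/-- Flip the `i`-th bit. -/
def flipAt {ι : Type*} [DecidableEq ι] (i : ι) (σ : ι → Bool) : ι → Bool :=
  Function.update σ i (!σ i)

theorem flipAt_involutive {ι : Type*} [DecidableEq ι] (i : ι) : Function.Involutive (flipAt i) :=
  fun σ => by simp [flipAt]

theorem exists_card_mul_half_le_sum {ι : Type*} [Finite ι] [DecidableEq ι] (S : Finset ι)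
    {G : (ι → Bool) → ι → ℝ} {V : ℝ} (hG : ∀ i ∈ S, ∀ σ, V ≤ G σ i + G (flipAt i σ) i) :
    ∃ σ, S.card * (V / 2) ≤ ∑ i ∈ S, G σ i := by
  cases nonempty_fintype ι
  have hbit : ∀ i ∈ S, ∑ _σ : ι → Bool, V / 2 ≤ ∑ σ, G σ i := by
    intro i hi
    have hflip : ∑ σ, G (flipAt i σ) i = ∑ σ, G σ i :=
      Equiv.sum_comp (flipAt_involutive i).toPerm fun σ => G σ i
    have hsum := Finset.sum_le_sum fun σ (_ : σ ∈ Finset.univ) => hG i hi σ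
    rw [Finset.sum_add_distrib, hflip] at hsum
    rw [← Finset.sum_div]
    linarith
  have htotal := Finset.sum_le_sum hbit
  rw [Finset.sum_const, nsmul_eq_mul, Finset.mul_sum, Finset.sum_comm] at htotal
  obtain ⟨σ, -, hσ⟩ := Finset.exists_le_of_sum_le Finset.univ_nonempty htotal
  exact ⟨σ, hσ⟩

end Assouad

namespace SBM

section Risk

variable {n K : ℕ}

/-- The success probabilities of the entries below the diagonal of the adjacency matrix. -/
def edgeProb (z : Fin n → Fin K) (P : Matrix (Fin K) (Fin K) unitInterval) (e : LowerPairs n) :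
    unitInterval :=
  P (z e.1.1) (z e.1.2)

theorem risk_eq_sum (zhat : Estimator n K) (z : Fin n → Fin K)
    (P : Matrix (Fin K) (Fin K) unitInterval) :
    risk zhat (z, P) = ∑ x : LowerPairs n → Bool, (bernoulliPi (edgeProb z P)).real {x} *
      ∑ y, (zhat (symmMatrix x) y).toReal * mis y z := by
  change ∫ A, ∑ y, (zhat A y).toReal * mis y z ∂(bernoulliPi (edgeProb z P)).map symmMatrix = _
  rw [integral_map Measurable.of_discrete.aemeasurable Measurable.of_discrete.aestronglyMeasurable,
    integral_fintype .of_finite]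
  simp only [smul_eq_mul]

theorem mis_eq_iInf_hammingDist (y z : Fin n → Fin K) :
    mis y z = ⨅ π : Equiv.Perm (Fin K), 1 / (n : ℝ) * hammingDist (π ∘ y) z := by
  simp only [mis, Finset.sum_boole, hammingDist, Function.comp_apply]

theorem mis_le_one (y z : Fin n → Fin K) : mis y z ≤ 1 := by
  rw [mis_eq_iInf_hammingDist]
  refine (ciInf_le (Set.finite_range _).bddBelow (Equiv.refl _)).trans ?_
  rw [one_div_mul_eq_div]
  refine div_le_one_of_le₀ ?_ n.cast_nonneg
  exact_mod_cast hammingDist_le_card_fintype.trans_eq (Fintype.card_fin n)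

theorem sum_pmf_toReal {Y : Type*} [Fintype Y] (φ : PMF Y) : ∑ y, (φ y).toReal = 1 := by
  rw [← ENNReal.toReal_sum fun y _ => φ.apply_ne_top y, ← tsum_fintype (L := .unconditional _),
    φ.tsum_coe, ENNReal.toReal_one]

theorem risk_le_one (zhat : Estimator n K)
    (θ : (Fin n → Fin K) × Matrix (Fin K) (Fin K) unitInterval) : risk zhat θ ≤ 1 := by
  obtain ⟨z, P⟩ := θ
  have hcond (x : LowerPairs n → Bool) : ∑ y, (zhat (symmMatrix x) y).toReal * mis y z ≤ 1 :=
    (Finset.sum_le_sum fun y _ =>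
      mul_le_of_le_one_right ENNReal.toReal_nonneg (mis_le_one y z)).trans_eq (sum_pmf_toReal _)
  rw [risk_eq_sum]
  calc _ ≤ ∑ x, (bernoulliPi (edgeProb z P)).real {x} :=
        Finset.sum_le_sum fun x _ => mul_le_of_le_one_right measureReal_nonneg (hcond x)
    _ = 1 := by rw [sum_measureReal_singleton, Finset.coe_univ, probReal_univ]

theorem le_minimaxRisk [Nonempty (Fin n → Fin K)] {c : ℝ}
    {S : Set ((Fin n → Fin K) × Matrix (Fin K) (Fin K) unitInterval)}
    (h : ∀ zhat : Estimator n K, ∃ θ ∈ S, c ≤ risk zhat θ) : c ≤ minimaxRisk S := by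
  have : Nonempty (Estimator n K) := ⟨fun _ => PMF.pure (Classical.arbitrary _)⟩
  refine le_ciInf fun zhat => ?_
  obtain ⟨θ, hθ, hc⟩ := h zhat
  refine hc.trans (le_ciSup (f := fun θ : S => risk zhat θ) ⟨1, ?_⟩ ⟨θ, hθ⟩)
  rintro _ ⟨θ, rfl⟩
  exact risk_le_one zhat θ

/-- The probability that the estimate of the label of the vertex `i` is wrong, when the estimated
labels `y` are renamed by `π y` before they are compared with `z`. -/
noncomputable def vertexRisk (zhat : Estimator n K)
    (π : (Fin n → Fin K) → Equiv.Perm (Fin K)) (z : Fin n → Fin K)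
    (P : Matrix (Fin K) (Fin K) unitInterval) (i : Fin n) : ℝ :=
  ∑ x : LowerPairs n → Bool, (bernoulliPi (edgeProb z P)).real {x} *
    ∑ y, (zhat (symmMatrix x) y).toReal * if π y (y i) ≠ z i then 1 else 0

theorem overlap_le_vertexRisk_add_vertexRisk (zhat : Estimator n K)
    (π : (Fin n → Fin K) → Equiv.Perm (Fin K)) {z z' : Fin n → Fin K}
    (P : Matrix (Fin K) (Fin K) unitInterval) {i : Fin n} (hi : z i ≠ z' i) :
    overlap (bernoulliPi (edgeProb z P)) (bernoulliPi (edgeProb z' P)) ≤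
      vertexRisk zhat π z P i + vertexRisk zhat π z' P i := by
  have hnonneg (w : Fin n → Fin K) (x : LowerPairs n → Bool) :
      0 ≤ ∑ y, (zhat (symmMatrix x) y).toReal * if π y (y i) ≠ w i then (1 : ℝ) else 0 :=
    Finset.sum_nonneg fun y _ => mul_nonneg ENNReal.toReal_nonneg (by split_ifs <;> norm_num)
  refine overlap_le_sum_add_sum _ _ (hnonneg z) (hnonneg z') fun x => ?_
  rw [← Finset.sum_add_distrib]
  refine (sum_pmf_toReal (zhat (symmMatrix x))).ge.trans (Finset.sum_le_sum fun y _ => ?_)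
  rw [← mul_add]
  refine le_mul_of_one_le_right ENNReal.toReal_nonneg ?_
  by_cases hy : π y (y i) = z i
  · simp [hy, hi]
  · rw [if_pos hy]
    split_ifs <;> norm_num

theorem sum_vertexRisk_le_risk (zhat : Estimator n K)
    {π : (Fin n → Fin K) → Equiv.Perm (Fin K)} {z : Fin n → Fin K}
    (P : Matrix (Fin K) (Fin K) unitInterval) {S : Finset (Fin n)}
    (hπ : ∀ y, 1 / (n : ℝ) * ∑ i ∈ S, (if π y (y i) ≠ z i then 1 else 0) ≤ mis y z) :
    1 / (n : ℝ) * ∑ i ∈ S, vertexRisk zhat π z P i ≤ risk zhat (z, P) := by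
  rw [risk_eq_sum]
  calc 1 / (n : ℝ) * ∑ i ∈ S, vertexRisk zhat π z P i
      = ∑ x : LowerPairs n → Bool, (bernoulliPi (edgeProb z P)).real {x} *
          ∑ y, (zhat (symmMatrix x) y).toReal *
            (1 / (n : ℝ) * ∑ i ∈ S, if π y (y i) ≠ z i then 1 else 0) := by
        simp only [vertexRisk, Finset.mul_sum]
        rw [Finset.sum_comm]
        refine Finset.sum_congr rfl fun x _ => ?_
        rw [Finset.sum_comm]
        exact Finset.sum_congr rfl fun y _ => Finset.sum_congr rfl fun i _ => by ring
    _ ≤ _ := Finset.sum_le_sum fun x _ => mul_le_mul_of_nonneg_left (Finset.sum_le_sum fun y _ =>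
        mul_le_mul_of_nonneg_left (hπ y) ENNReal.toReal_nonneg) measureReal_nonneg

theorem eq_of_hammingDist_comp_add_lt_communitySize {π π' : Equiv.Perm (Fin K)}
    {y z : Fin n → Fin K}
    (h : ∀ k, hammingDist (π ∘ y) z + hammingDist (π' ∘ y) z < communitySize z k) : π = π' := by
  ext1 a
  by_contra hne
  have hsub : (Finset.univ.filter fun i => z i = π a) ⊆
      (Finset.univ.filter fun i => (π ∘ y) i ≠ z i) ∪
        Finset.univ.filter fun i => (π' ∘ y) i ≠ z i := by
    intro i hi
    simp only [Finset.mem_union, Finset.mem_filter, Finset.mem_univ, true_and,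
      Function.comp_apply] at hi ⊢
    by_contra! hcorrect
    rw [hi] at hcorrect
    exact hne (π.injective hcorrect.1 ▸ hcorrect.2).symm
  exact ((Finset.card_le_card hsub).trans (Finset.card_union_le _ _)).not_gt (h (π a))

theorem exists_perm_forall_le_mis {ι : Type*} (z : ι → Fin n → Fin K) (σ₀ : ι)
    (S : Finset (Fin n)) (hz : ∀ σ, ∀ i ∉ S, z σ i = z σ₀ i)
    (hsize : ∀ k, 4 * S.card ≤ communitySize (z σ₀) k) (y : Fin n → Fin K) :
    ∃ π : Equiv.Perm (Fin K), ∀ σ,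
      1 / (n : ℝ) * ∑ i ∈ S, (if π (y i) ≠ z σ i then 1 else 0) ≤ mis y (z σ) := by
  obtain ⟨π₀, hπ₀⟩ := Finite.exists_min fun π : Equiv.Perm (Fin K) => hammingDist (π ∘ y) (z σ₀)
  refine ⟨π₀, fun σ => ?_⟩
  rw [mis_eq_iInf_hammingDist, Finset.sum_boole]
  refine le_ciInf fun π => mul_le_mul_of_nonneg_left (Nat.cast_le.2 ?_) (by positivity)
  rcases le_or_gt S.card (hammingDist (π ∘ y) (z σ)) with hfar | hclose
  · exact (Finset.card_filter_le _ _).trans hfar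
  · have hdist : hammingDist (z σ) (z σ₀) ≤ S.card :=
      Finset.card_le_card fun i hi => by
        by_contra hiS
        exact (Finset.mem_filter.1 hi).2 (hz σ i hiS)
    have htriangle := hammingDist_triangle (π ∘ y) (z σ) (z σ₀)
    have hmin := hπ₀ π
    obtain rfl : π = π₀ := eq_of_hammingDist_comp_add_lt_communitySize (y := y) fun k =>
      lt_of_lt_of_le (by omega) (hsize k)
    exact Finset.card_le_card (Finset.filter_subset_filter _ (Finset.subset_univ S))

theorem exists_card_mul_half_le_risk {z : (Fin n → Bool) → Fin n → Fin K}
    {P : Matrix (Fin K) (Fin K) unitInterval} {S : Finset (Fin n)} {V : ℝ} (σ₀ : Fin n → Bool)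
    (hz : ∀ σ, ∀ i ∉ S, z σ i = z σ₀ i) (hsize : ∀ k, 4 * S.card ≤ communitySize (z σ₀) k)
    (hne : ∀ i ∈ S, ∀ σ, z σ i ≠ z (flipAt i σ) i)
    (hV : ∀ i ∈ S, ∀ σ,
      V ≤ overlap (bernoulliPi (edgeProb (z σ) P)) (bernoulliPi (edgeProb (z (flipAt i σ)) P)))
    (zhat : Estimator n K) :
    ∃ σ, 1 / (n : ℝ) * (S.card * (V / 2)) ≤ risk zhat (z σ, P) := by
  choose π hπ using exists_perm_forall_le_mis z σ₀ S hz hsize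
  obtain ⟨σ, hσ⟩ := exists_card_mul_half_le_sum S (G := fun σ => vertexRisk zhat π (z σ) P)
    fun i hi σ => (hV i hi σ).trans (overlap_le_vertexRisk_add_vertexRisk zhat π P (hne i hi σ))
  exact ⟨σ, (mul_le_mul_of_nonneg_left hσ (by positivity)).trans
    (sum_vertexRisk_le_risk zhat P fun y => hπ y σ)⟩

end Risk

end SBM

namespace SBM

section HalfGraph

variable {K : ℕ} {p q : unitInterval}

/-- The connectivity matrix with entry `p` where `k + l ≥ K` and `q` elsewhere. Its rows are
nested: row `l` has `l` entries equal to `p`, in the last `l` columns. -/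
def halfGraphMatrix (K : ℕ) (p q : unitInterval) : Matrix (Fin K) (Fin K) unitInterval :=
  fun k l => if K ≤ (k : ℕ) + l then p else q

theorem halfGraphMatrix_eq_or_eq (k l : Fin K) :
    halfGraphMatrix K p q k l = p ∨ halfGraphMatrix K p q k l = q :=
  ite_eq_or_eq _ _ _

theorem halfGraphMatrix_isSymm (K : ℕ) (p q : unitInterval) : (halfGraphMatrix K p q).IsSymm := by
  ext k l
  simp only [Matrix.transpose_apply, halfGraphMatrix, add_comm]

theorem exists_halfGraphMatrix_eq_of_lt (p q : unitInterval) {k l : Fin K} (hkl : k < l) :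
    ∃ r : Fin K, 0 < (r : ℕ) ∧ halfGraphMatrix K p q k r = q ∧ halfGraphMatrix K p q l r = p := by
  rw [Fin.lt_def] at hkl
  have hl := l.isLt
  exact ⟨⟨K - l, by omega⟩, Nat.sub_pos_of_lt hl, if_neg (by dsimp only; omega),
    if_pos (by dsimp only; omega)⟩

theorem le_halfGraphMatrix (hqp : (q : ℝ) ≤ p) (k l : Fin K) :
    (q : ℝ) ≤ halfGraphMatrix K p q k l := by
  rcases halfGraphMatrix_eq_or_eq (p := p) (q := q) k l with h | h <;> rw [h]
  exact hqp

theorem halfGraphMatrix_le (hqp : (q : ℝ) ≤ p) (k l : Fin K) :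
    (halfGraphMatrix K p q k l : ℝ) ≤ p := by
  rcases halfGraphMatrix_eq_or_eq (p := p) (q := q) k l with h | h <;> rw [h]
  exact hqp

theorem exists_le_max_div_halfGraphMatrix {ω' : ℝ} (hω' : ω' ≤ (p : ℝ) / q) {k l : Fin K}
    (hkl : k ≠ l) :
    ∃ r, ω' ≤ max ((halfGraphMatrix K p q k r : ℝ) / halfGraphMatrix K p q l r)
      ((halfGraphMatrix K p q l r : ℝ) / halfGraphMatrix K p q k r) := by
  rcases lt_or_gt_of_ne hkl with h | h <;>
    obtain ⟨r, -, hq, hp⟩ := exists_halfGraphMatrix_eq_of_lt p q h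
  · exact ⟨r, by rw [hq, hp]; exact hω'.trans (le_max_right _ _)⟩
  · exact ⟨r, by rw [hq, hp]; exact hω'.trans (le_max_left _ _)⟩

theorem chernoffInfo_binomial_le_halfGraphMatrix {n m : ℕ} (hqp : (q : ℝ) ≤ p) (hp : (p : ℝ) < 1)
    {z : Fin n → Fin K} (hz : ∀ r : Fin K, 0 < (r : ℕ) → m ≤ communitySize z r) {k l : Fin K}
    (hkl : k ≠ l) :
    chernoffInfo (binomial m p) (binomial m q) ≤
      chernoffInfo (bernoulliVector fun j => halfGraphMatrix K p q k (z j))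
        (bernoulliVector fun j => halfGraphMatrix K p q l (z j)) := by
  wlog hlt : l < k generalizing k l
  · rw [chernoffInfo_comm (bernoulliVector _)]
    exact this hkl.symm (hkl.lt_or_gt.resolve_right hlt)
  obtain ⟨r, hr, hlr, hkr⟩ := exists_halfGraphMatrix_eq_of_lt p q hlt
  refine chernoffInfo_binomial_le_bernoulliVector
    (fun j => (halfGraphMatrix_le hqp _ _).trans_lt hp)
    (fun j => (halfGraphMatrix_le hqp _ _).trans_lt hp) (hz r hr) ?_ ?_ <;>
  · intro j hj
    rw [(Finset.mem_filter.1 hj).2]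
    assumption

end HalfGraph

section BlockLabel

variable {n K m s : ℕ}

theorem sub_le_communitySize {a b : ℕ} {z : Fin n → Fin K} {k : Fin K} (hb : b ≤ n)
    (h : ∀ i : Fin n, a ≤ i → i < b → z i = k) : b - a ≤ communitySize z k := by
  have hlt : ∀ j ∈ Finset.Ico a b, j < n := fun j hj => (Finset.mem_Ico.1 hj).2.trans_le hb
  rw [← Nat.card_Ico, ← Finset.card_attachFin _ hlt]
  refine Finset.card_le_card fun i hi => Finset.mem_filter.2 ⟨Finset.mem_univ i, ?_⟩
  rw [Finset.mem_attachFin, Finset.mem_Ico] at hi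
  exact h i hi.1 hi.2

theorem communitySize_le_card {z : Fin n → Fin K} {k : Fin K} {T : Finset ℕ}
    (h : ∀ i, z i = k → (i : ℕ) ∈ T) : communitySize z k ≤ T.card :=
  Finset.card_le_card_of_injOn Fin.val (fun i hi => h i (Finset.mem_filter.1 hi).2)
    Fin.val_injective.injOn

/-- The edges between the vertex `i` and the last block. -/
def lastBlockEdges (K m : ℕ) (i : Fin n) : Finset (LowerPairs n) :=
  Finset.univ.filter fun e => e.1.2 = i ∧ (e.1.1 : ℕ) ∈ Finset.Ico ((K - 1) * m) (K * m)

theorem card_lastBlockEdges (hK : 1 ≤ K) (hn : K * m ≤ n) {i : Fin n} (hi : (i : ℕ) < (K - 1) * m) :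
    (lastBlockEdges K m i).card = m := by
  have hlen : K * m - (K - 1) * m = m := by
    rw [← Nat.sub_mul, Nat.sub_sub_self hK, one_mul]
  refine Eq.trans ?_ ((Nat.card_Ico ((K - 1) * m) (K * m)).trans hlen)
  refine Finset.card_bij (fun e _ => (e.1.1 : ℕ)) (fun e he => (Finset.mem_filter.1 he).2.2) ?_ ?_
  · intro e he e' he' h
    exact Subtype.ext (Prod.ext (Fin.ext h)
      ((Finset.mem_filter.1 he).2.1.trans (Finset.mem_filter.1 he').2.1.symm))
  · intro j hj
    have hjI := Finset.mem_Ico.1 hj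
    exact ⟨⟨(⟨j, hjI.2.trans_le hn⟩, i), hi.trans_le hjI.1⟩,
      Finset.mem_filter.2 ⟨Finset.mem_univ _, rfl, hj⟩, rfl⟩

/-- Labels in consecutive blocks: vertex `i` has label `i / m`, except that the vertices from
`K * m` on have label `0`, and each of the first `s` vertices has label `1` or `0` according to its
bit of `σ`. -/
def blockLabel (hK : 3 ≤ K) (m s : ℕ) (σ : Fin n → Bool) (i : Fin n) : Fin K :=
  ⟨if (i : ℕ) < s then (σ i).toNat else if (i : ℕ) / m < K then i / m else 0, by
    split_ifs with _ hi
    exacts [(σ i).toNat_lt.trans hK, hi, two_pos.trans hK]⟩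

variable (hK : 3 ≤ K)

theorem blockLabel_val_of_lt (σ : Fin n → Bool) {i : Fin n} (hi : (i : ℕ) < s) :
    (blockLabel hK m s σ i : ℕ) = (σ i).toNat :=
  if_pos hi

theorem blockLabel_congr {σ τ : Fin n → Bool} {i : Fin n} (h : (i : ℕ) < s → σ i = τ i) :
    blockLabel hK m s σ i = blockLabel hK m s τ i := by
  ext
  by_cases hi : (i : ℕ) < s
  · rw [blockLabel_val_of_lt hK σ hi, blockLabel_val_of_lt hK τ hi, h hi]
  · simp only [blockLabel, if_neg hi]

theorem blockLabel_ne_flipAt {i : Fin n} (hi : (i : ℕ) < s) (σ : Fin n → Bool) :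
    blockLabel hK m s σ i ≠ blockLabel hK m s (flipAt i σ) i := by
  rw [Ne, Fin.ext_iff, blockLabel_val_of_lt hK σ hi, blockLabel_val_of_lt hK _ hi]
  cases hσ : σ i <;> simp [flipAt, hσ]

theorem blockLabel_eq_of_mem_block (σ : Fin n → Bool) {i : Fin n} {k : Fin K} (hi : s ≤ (i : ℕ))
    (hle : (k : ℕ) * m ≤ i) (hlt : (i : ℕ) < (k + 1) * m) : blockLabel hK m s σ i = k := by
  have hdiv : (i : ℕ) / m = k := Nat.div_eq_of_lt_le hle hlt
  ext
  simp only [blockLabel, if_neg hi.not_gt, hdiv, if_pos k.isLt]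

theorem mem_block_of_blockLabel_eq (hm : 0 < m) {σ : Fin n → Bool} {i : Fin n} {k : Fin K}
    (h : blockLabel hK m s σ i = k) :
    (i : ℕ) ∈ Finset.Ico ((k : ℕ) * m) ((k + 1) * m) ∨ (i : ℕ) < s ∧ (k : ℕ) ≤ 1 ∨
      K * m ≤ i ∧ (k : ℕ) = 0 := by
  subst h
  by_cases hi : (i : ℕ) < s
  · rw [blockLabel_val_of_lt hK σ hi]
    exact Or.inr (Or.inl ⟨hi, Bool.toNat_le _⟩)
  by_cases hdiv : (i : ℕ) / m < K
  · left
    simp only [blockLabel, if_neg hi, if_pos hdiv, Finset.mem_Ico]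
    exact ⟨Nat.div_mul_le_self _ _, Nat.lt_mul_of_div_lt (Nat.lt_succ_self _) hm⟩
  · right; right
    simp only [blockLabel, if_neg hi, if_neg hdiv, and_true]
    exact (Nat.le_div_iff_mul_le hm).1 (not_lt.1 hdiv)

theorem blockLabel_val_eq_pred_iff (hm : 0 < m) (hsm : s ≤ m) (σ : Fin n → Bool) (i : Fin n) :
    (blockLabel hK m s σ i : ℕ) = K - 1 ↔ (i : ℕ) ∈ Finset.Ico ((K - 1) * m) (K * m) := by
  have hK1 : K - 1 + 1 = K := by omega
  have hm' : 1 * m ≤ (K - 1) * m := Nat.mul_le_mul_right m (by omega)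
  constructor <;> intro h
  · rcases mem_block_of_blockLabel_eq hK hm (k := ⟨K - 1, by omega⟩) (Fin.ext h) with h | h | h
    · rwa [hK1] at h
    · exact absurd h.2 (by dsimp only; omega)
    · exact absurd h.2 (by dsimp only; omega)
  · rw [Finset.mem_Ico] at h
    exact congrArg Fin.val (blockLabel_eq_of_mem_block hK σ (k := ⟨K - 1, by omega⟩) (by omega)
      h.1 (by rw [hK1]; exact h.2))

theorem sub_le_communitySize_blockLabel (hn : K * m ≤ n) (σ : Fin n → Bool) (k : Fin K) :
    m - s ≤ communitySize (blockLabel hK m s σ) k := by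
  have hk : ((k : ℕ) + 1) * m ≤ K * m := Nat.mul_le_mul_right m k.isLt
  have hlen : ((k : ℕ) + 1) * m - (k * m + s) = m - s := by rw [add_mul]; omega
  exact hlen.ge.trans (sub_le_communitySize (hk.trans hn) fun i hle hlt =>
    blockLabel_eq_of_mem_block hK σ (by omega) (by omega) hlt)

theorem le_communitySize_blockLabel_of_pos (hsm : s ≤ m) (hn : K * m ≤ n) (σ : Fin n → Bool)
    {k : Fin K} (hk0 : 0 < (k : ℕ)) : m ≤ communitySize (blockLabel hK m s σ) k := by
  have hk : ((k : ℕ) + 1) * m ≤ K * m := Nat.mul_le_mul_right m k.isLt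
  have hmk : m ≤ (k : ℕ) * m := Nat.le_mul_of_pos_left m hk0
  have hlen : ((k : ℕ) + 1) * m - k * m = m := by rw [add_mul]; omega
  exact hlen.ge.trans (sub_le_communitySize (hk.trans hn) fun i hle hlt =>
    blockLabel_eq_of_mem_block hK σ (by omega) hle hlt)

theorem communitySize_blockLabel_le (hm : 0 < m) (σ : Fin n → Bool) (k : Fin K) :
    communitySize (blockLabel hK m s σ) k ≤ m + s + (n - K * m) := by
  have hlen : ((k : ℕ) + 1) * m - k * m = m := by rw [add_mul]; omega
  calc communitySize (blockLabel hK m s σ) k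
      ≤ (Finset.Ico ((k : ℕ) * m) ((k + 1) * m) ∪ Finset.range s ∪ Finset.Ico (K * m) n).card := by
        refine communitySize_le_card fun i hi => ?_
        rw [Finset.mem_union, Finset.mem_union, Finset.mem_range, Finset.mem_Ico (a := K * m)]
        rcases mem_block_of_blockLabel_eq hK hm hi with h | h | h
        · exact Or.inl (Or.inl h)
        · exact Or.inl (Or.inr h.1)
        · exact Or.inr ⟨h.1, i.isLt⟩
    _ ≤ m + s + (n - K * m) := by
        refine (Finset.card_union_le _ _).trans (add_le_add ((Finset.card_union_le _ _).trans ?_)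
          (Nat.card_Ico _ _).le)
        rw [Nat.card_Ico, hlen, Finset.card_range]

theorem edgeProb_blockLabel_of_mem (hm : 0 < m) (hsm : s ≤ m) {p q : unitInterval} {i : Fin n}
    (hi : (i : ℕ) < s) (σ : Fin n → Bool) {e : LowerPairs n} (he : e ∈ lastBlockEdges K m i) :
    edgeProb (blockLabel hK m s σ) (halfGraphMatrix K p q) e = if σ i then p else q := by
  obtain ⟨-, hei, hlast⟩ := Finset.mem_filter.1 he
  have hlabel := (blockLabel_val_eq_pred_iff hK hm hsm σ e.1.1).2 hlast
  rw [edgeProb, halfGraphMatrix, hlabel, hei, blockLabel_val_of_lt hK σ hi]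
  cases σ i
  · exact if_neg (by simp only [Bool.toNat_false]; omega)
  · exact if_pos (by simp only [Bool.toNat_true]; omega)

theorem edgeProb_blockLabel_flipAt_of_notMem (hm : 0 < m) (hsm : s ≤ m) {p q : unitInterval}
    {i : Fin n} (hi : (i : ℕ) < s) (σ : Fin n → Bool) {e : LowerPairs n}
    (he : e ∉ lastBlockEdges K m i) :
    edgeProb (blockLabel hK m s σ) (halfGraphMatrix K p q) e =
      edgeProb (blockLabel hK m s (flipAt i σ)) (halfGraphMatrix K p q) e := by
  have hoff (j : Fin n) (hj : j ≠ i) : blockLabel hK m s σ j = blockLabel hK m s (flipAt i σ) j :=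
    blockLabel_congr hK fun _ => (Function.update_of_ne hj _ _).symm
  have hle (τ : Fin n → Bool) (j : Fin n) (hj : (j : ℕ) < s) :
      (blockLabel hK m s τ j : ℕ) ≤ 1 := by
    rw [blockLabel_val_of_lt hK τ hj]
    exact Bool.toNat_le _
  obtain ⟨⟨j, k⟩, hkj : k < j⟩ := e
  rw [Fin.lt_def] at hkj
  by_cases hk : k = i
  · subst hk
    have hjne : j ≠ k := fun h => by rw [h] at hkj; exact hkj.false
    have hj : (blockLabel hK m s σ j : ℕ) ≠ K - 1 := fun h =>
      he (Finset.mem_filter.2 ⟨Finset.mem_univ _, rfl,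
        (blockLabel_val_eq_pred_iff hK hm hsm σ j).1 h⟩)
    have hjK := (blockLabel hK m s σ j).isLt
    have := hle σ k hi
    have := hle (flipAt k σ) k hi
    simp only [edgeProb, halfGraphMatrix, ← hoff j hjne]
    rw [if_neg (by omega), if_neg (by omega)]
  by_cases hj : j = i
  · subst hj
    have := hle σ j hi
    have := hle (flipAt j σ) j hi
    have := hle σ k (hkj.trans hi)
    simp only [edgeProb, halfGraphMatrix, ← hoff k hk]
    rw [if_neg (by omega), if_neg (by omega)]
  · simp only [edgeProb, hoff j hj, hoff k hk]

theorem choose_mul_min_le_overlap_blockLabel_flipAt (hm : 0 < m) (hsm : s ≤ m) (hn : K * m ≤ n)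
    (p q : unitInterval) {i : Fin n} (hi : (i : ℕ) < s) (σ : Fin n → Bool) {k l : ℕ}
    (hkl : k + l = m) :
    m.choose k * min ((p : ℝ) ^ k * (1 - p) ^ l) ((q : ℝ) ^ k * (1 - q) ^ l) ≤
      overlap (bernoulliPi (edgeProb (blockLabel hK m s σ) (halfGraphMatrix K p q)))
        (bernoulliPi (edgeProb (blockLabel hK m s (flipAt i σ)) (halfGraphMatrix K p q))) := by
  wlog hσ : σ i = true generalizing σ
  · have hflip : flipAt i σ i = true := by simp [flipAt, hσ]
    have h := this (flipAt i σ) hflip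
    rwa [flipAt_involutive i σ, overlap_comm] at h
  have hcard : (lastBlockEdges K m i).card = m :=
    card_lastBlockEdges (by omega) hn
      ((hi.trans_le hsm).trans_le (Nat.le_mul_of_pos_left m (by omega)))
  have h := choose_mul_min_le_overlap_bernoulliPi (p := p) (q := q) (E := lastBlockEdges K m i)
    (fun e he => (edgeProb_blockLabel_of_mem hK hm hsm hi σ he).trans (if_pos hσ))
    (fun e he => (edgeProb_blockLabel_of_mem hK hm hsm hi (flipAt i σ) he).trans
      (if_neg (by simp [flipAt, hσ])))
    (fun e he => edgeProb_blockLabel_flipAt_of_notMem hK hm hsm hi σ he) (hkl.trans hcard.symm)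
  rwa [hcard] at h

end BlockLabel
end SBM

namespace SBM

section Construction

variable {β ε ω ω' : ℝ} {n K m s : ℕ} {p q : unitInterval}

/-- The sizes `m` of the blocks and `s` of the set of vertices with an uncertain label for which
the block labellings of `n` vertices with `K` labels are balanced up to the factor `β`, and the
certain vertices of each label outnumber the uncertain ones four to one. -/
structure BlockSizes (β : ℝ) (n K m s : ℕ) : Prop where
  pos : 0 < m
  five_mul_le : 5 * s ≤ m
  mul_le : K * m ≤ n
  le_sub : (n : ℝ) / (β * K) ≤ ((m - s : ℕ) : ℝ)
  add_le : ((m + s + (n - K * m) : ℕ) : ℝ) ≤ β * n / K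

theorem BlockSizes.le (h : BlockSizes β n K m s) : s ≤ m := by
  have := h.five_mul_le
  omega

theorem admissible_blockLabel (hK : 3 ≤ K) (h : BlockSizes β n K m s) (hq : 0 < (q : ℝ))
    (hqp : (q : ℝ) ≤ p) (hp : (p : ℝ) < 1) (hpε : (p : ℝ) ≤ 1 - ε) (hω' : ω' ≤ (p : ℝ) / q)
    (hω : (p : ℝ) / q ≤ ω) (σ : Fin n → Bool) :
    Admissible β ε ω ω' p (chernoffInfo (binomial m p) (binomial m q)) (blockLabel hK m s σ)
      (halfGraphMatrix K p q) where
  pos k l := hq.trans_le (le_halfGraphMatrix hqp k l)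
  lt_one k l := (halfGraphMatrix_le hqp k l).trans_lt hp
  symm := halfGraphMatrix_isSymm K p q
  balanced k := ⟨h.le_sub.trans (by exact_mod_cast sub_le_communitySize_blockLabel hK h.mul_le σ k),
    le_trans (by exact_mod_cast communitySize_blockLabel_le hK h.pos σ k) h.add_le⟩
  max_eq := ⟨halfGraphMatrix_le hqp, ⟨K - 1, by omega⟩, ⟨K - 1, by omega⟩,
    if_pos (by dsimp only; omega)⟩
  max_le := hpε
  ratio_le k l k' l' := (div_le_div₀ p.2.1 (halfGraphMatrix_le hqp k l) hq
    (le_halfGraphMatrix hqp k' l')).trans hω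
  separated _ _ hkl := exists_le_max_div_halfGraphMatrix hω' hkl
  chernoff _ _ hkl := chernoffInfo_binomial_le_halfGraphMatrix hqp hp
    (fun _ hr => le_communitySize_blockLabel_of_pos hK h.le h.mul_le σ hr) hkl

theorem le_minimaxRisk_paramSpace (hK : 3 ≤ K) (h : BlockSizes β n K m s) (hq : 0 < (q : ℝ))
    (hqp : (q : ℝ) ≤ p) (hp : (p : ℝ) < 1) (hpε : (p : ℝ) ≤ 1 - ε) (hω' : ω' ≤ (p : ℝ) / q)
    (hω : (p : ℝ) / q ≤ ω) {k l : ℕ} (hkl : k + l = m) :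
    1 / (n : ℝ) * (s * (m.choose k *
      min ((p : ℝ) ^ k * (1 - p) ^ l) ((q : ℝ) ^ k * (1 - q) ^ l) / 2)) ≤
      minimaxRisk (paramSpace β ε ω ω' n p K (chernoffInfo (binomial m p) (binomial m q))) := by
  let σ₀ : Fin n → Bool := fun _ => false
  have : Nonempty (Fin n → Fin K) := ⟨blockLabel hK m s σ₀⟩
  refine le_minimaxRisk fun zhat => ?_
  have hsn : s ≤ n := h.le.trans ((Nat.le_mul_of_pos_left m (by omega)).trans h.mul_le)
  set S : Finset (Fin n) := Finset.univ.filter fun i => (i : ℕ) < s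
  have hS (i : Fin n) : i ∈ S ↔ (i : ℕ) < s := by simp [S]
  have hcard : S.card = s := Fin.card_filter_val_lt.trans (min_eq_right hsn)
  have hz (σ : Fin n → Bool) (i : Fin n) (hi : i ∉ S) :
      blockLabel hK m s σ i = blockLabel hK m s σ₀ i :=
    blockLabel_congr hK fun his => absurd ((hS i).2 his) hi
  have hsize (r : Fin K) : 4 * S.card ≤ communitySize (blockLabel hK m s σ₀) r := by
    have := h.five_mul_le
    exact le_trans (by omega) (sub_le_communitySize_blockLabel hK h.mul_le _ r)
  obtain ⟨σ, hσ⟩ := exists_card_mul_half_le_risk σ₀ hz hsize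
    (fun i hi => blockLabel_ne_flipAt hK ((hS i).1 hi))
    (fun i hi σ => choose_mul_min_le_overlap_blockLabel_flipAt hK h.pos h.le h.mul_le p q
      ((hS i).1 hi) σ hkl) zhat
  rw [hcard] at hσ
  exact ⟨_, admissible_blockLabel hK h hq hqp hp hpε hω' hω σ, hσ⟩

end Construction

end SBM

theorem exists_exp_neg_chernoffInfo_le_choose_mul_min {ε ω : ℝ} (hε : 0 < ε) {p q : unitInterval}
    (hq : 0 < (q : ℝ)) (hqp : (q : ℝ) ≤ p) (hpε : (p : ℝ) ≤ 1 - ε) (hω : (p : ℝ) / q ≤ ω) {m : ℕ}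
    (hmq : 1 ≤ m * (q : ℝ)) (hmε : 2 ≤ m * ε) :
    ∃ k l, k + l = m ∧ Real.exp (-4) * (ε / ω) *
        (1 / √(m * p) * Real.exp (-chernoffInfo (binomial m p) (binomial m q))) ≤
      m.choose k * min ((p : ℝ) ^ k * (1 - p) ^ l) ((q : ℝ) ^ k * (1 - q) ^ l) := by
  have hp : (p : ℝ) < 1 := by linarith
  have hp0 : 0 < (p : ℝ) := hq.trans_le hqp
  have hω0 : 0 < ω := (div_pos hp0 hq).trans_le hω
  have hmp : 2 ≤ m * (1 - (p : ℝ)) :=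
    hmε.trans (mul_le_mul_of_nonneg_left (by linarith) m.cast_nonneg)
  obtain ⟨α, hα, k, l, hkl, hV⟩ := exists_bernoulliAffinity_pow_le_choose_mul_min hq hqp hp hmq hmp
  refine ⟨k, l, hkl, ?_⟩
  set V := m.choose k * min ((p : ℝ) ^ k * (1 - p) ^ l) ((q : ℝ) ^ k * (1 - q) ^ l)
  have hV0 : 0 ≤ V := mul_nonneg (Nat.cast_nonneg _)
    (le_min (mul_nonneg (pow_nonneg p.2.1 _) (pow_nonneg (by linarith) _))
      (mul_nonneg (pow_nonneg q.2.1 _) (pow_nonneg (by linarith) _)))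
  have hodds : p * (1 - q) / (q * (1 - p)) ≤ ω / ε := by
    have hcompl : (1 - (q : ℝ)) / (1 - p) ≤ 1 / ε :=
      div_le_div₀ zero_le_one (by linarith) hε (by linarith)
    rw [mul_div_mul_comm, div_eq_mul_one_div ω]
    exact mul_le_mul hω hcompl (div_nonneg (by linarith) (by linarith)) hω0.le
  calc _ = ε / ω * (Real.exp (-4) / √(m * p) *
          Real.exp (-chernoffInfo (binomial m p) (binomial m q))) := by ring
    _ ≤ ε / ω * (Real.exp (-4) / √(m * p) * bernoulliAffinity α p q ^ m) := by
        gcongr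
        exact exp_neg_chernoffInfo_binomial_le hp (hqp.trans_lt hp) hα m
    _ ≤ ε / ω * (ω / ε * V) := by
        exact mul_le_mul_of_nonneg_left (hV.trans (mul_le_mul_of_nonneg_right hodds hV0))
          (div_pos hε hω0).le
    _ = V := by field_simp

theorem lt_natDiv_add_one (n K : ℕ) : (n : ℝ) / K < (n / K : ℕ) + 1 := by
  rw [← Nat.floor_div_eq_div (K := ℝ)]
  exact Nat.lt_floor_add_one _

namespace SBM

theorem blockSizes_floor {β γ : ℝ} {n K : ℕ} (hβ : 1 < β) (hγ : 0 ≤ γ) (hγ16 : γ ≤ 1 / 16)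
    (hγβ : γ * (4 * β) ≤ β - 1) (hK : 0 < K) (hn : 2 ≤ (n : ℝ) / K)
    (hnβ : 2 * β ≤ (n : ℝ) / K * (β - 1)) (hnK : 2 * K ≤ (n : ℝ) / K * (β - 1)) :
    BlockSizes β n K (n / K) ⌊γ * ((n : ℝ) / K)⌋₊ := by
  set x := (n : ℝ) / K with hx
  have hx0 : 0 ≤ x := by linarith
  have hmx : ((n / K : ℕ) : ℝ) ≤ x := Nat.cast_div_le
  have hxm : x < (n / K : ℕ) + 1 := lt_natDiv_add_one n K
  have hsx : (⌊γ * x⌋₊ : ℝ) ≤ γ * x := Nat.floor_le (mul_nonneg hγ hx0)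
  have hγx : γ * x ≤ 1 / 16 * x := mul_le_mul_of_nonneg_right hγ16 hx0
  have hγβx : γ * (4 * β) * x ≤ (β - 1) * x := mul_le_mul_of_nonneg_right hγβ hx0
  have hsm : 5 * ⌊γ * x⌋₊ ≤ n / K := by
    have : 5 * (⌊γ * x⌋₊ : ℝ) ≤ (n / K : ℕ) := by linarith
    exact_mod_cast this
  refine ⟨?_, hsm, Nat.mul_div_le n K, ?_, ?_⟩
  · have : (0 : ℝ) < (n / K : ℕ) := by linarith
    exact_mod_cast this
  · rw [Nat.cast_sub (by omega), mul_comm β, ← div_div, ← hx, div_le_iff₀ (by linarith)]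
    have : (x - 1 - γ * x) * β ≤ ((n / K : ℕ) - ⌊γ * x⌋₊) * β :=
      mul_le_mul_of_nonneg_right (by linarith) (by linarith)
    linarith
  · have hrem : ((n - K * (n / K) : ℕ) : ℝ) ≤ K := by
      rw [← Nat.mod_eq_sub_mul_div]
      exact_mod_cast (Nat.mod_lt n hK).le
    have hγ1 : γ * 1 * x ≤ γ * β * x := by gcongr
    rw [mul_div_assoc, ← hx, Nat.cast_add, Nat.cast_add]
    linarith

theorem exists_forall_ge_blockSizes {β : ℝ} (hβ : 1 < β) (Kstar : ℕ) :
    ∃ γ : ℝ, 0 < γ ∧ ∃ X : ℝ, ∀ n K : ℕ, 0 < K → K ≤ Kstar → X ≤ (n : ℝ) / K →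
      ∃ s, BlockSizes β n K (n / K) s ∧ γ ≤ (s : ℝ) / n := by
  set γ := min (1 / 16) ((β - 1) / (4 * β))
  have hβ1 : 0 < β - 1 := by linarith
  have hγ : 0 < γ := by positivity
  have hγβ : γ * (4 * β) ≤ β - 1 := (le_div_iff₀ (by positivity)).1 (min_le_right _ _)
  refine ⟨γ / (2 * (Kstar + 1)), by positivity,
    2 + 2 * β / (β - 1) + 2 * Kstar / (β - 1) + 2 / γ, fun n K hK hKK hX => ?_⟩
  have hKK' : (K : ℝ) ≤ Kstar := by exact_mod_cast hKK
  have hβn : 0 ≤ 2 * β / (β - 1) := by positivity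
  have hKn : 0 ≤ 2 * Kstar / (β - 1) := by positivity
  have hγn : 0 ≤ 2 / γ := by positivity
  refine ⟨_, blockSizes_floor hβ hγ.le (min_le_left _ _) hγβ hK (by linarith)
    ((div_le_iff₀ hβ1).1 (by linarith)) (le_trans (by linarith) ((div_le_iff₀ hβ1).1
      (by linarith : 2 * Kstar / (β - 1) ≤ (n : ℝ) / K))), ?_⟩
  have hfloor := Nat.lt_floor_add_one (γ * ((n : ℝ) / K))
  have hlarge : 2 ≤ (n : ℝ) / K * γ := (div_le_iff₀ hγ).1 (by linarith)
  have hK0 : (0 : ℝ) < K := by exact_mod_cast hK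
  have hn0 : (0 : ℝ) < n := by
    by_contra! h
    have := div_nonpos_of_nonpos_of_nonneg h hK0.le
    linarith
  calc γ / (2 * (Kstar + 1)) ≤ γ / (2 * K) := by gcongr; linarith
    _ = γ * (n / K) / 2 / n := by field_simp
    _ ≤ _ := by gcongr; linarith

theorem le_minimaxRisk_of_blockSizes {β γ ε ω ω' : ℝ} {n K m s : ℕ} {p q : unitInterval}
    (hK : 3 ≤ K) (h : BlockSizes β n K m s) (hγ : γ ≤ (s : ℝ) / n) (hε : 0 < ε) (hq : 0 < (q : ℝ))
    (hqp : (q : ℝ) ≤ p) (hpε : (p : ℝ) ≤ 1 - ε) (hω' : ω' ≤ (p : ℝ) / q) (hω : (p : ℝ) / q ≤ ω)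
    (hmq : 1 ≤ m * (q : ℝ)) (hmε : 2 ≤ m * ε) :
    γ / 2 * (Real.exp (-4) * (ε / ω)) *
        (1 / √(n * p) * Real.exp (-chernoffInfo (binomial m p) (binomial m q))) ≤
      minimaxRisk (paramSpace β ε ω ω' n p K (chernoffInfo (binomial m p) (binomial m q))) := by
  obtain ⟨k, l, hkl, hV⟩ :=
    exists_exp_neg_chernoffInfo_le_choose_mul_min hε hq hqp hpε hω hmq hmε
  refine le_trans ?_ (le_minimaxRisk_paramSpace hK h hq hqp (by linarith) hpε hω' hω hkl)
  have hm0 : (0 : ℝ) < m := by exact_mod_cast h.pos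
  have hp0 : 0 < (p : ℝ) := hq.trans_le hqp
  have hω0 : 0 < ω := (div_pos hp0 hq).trans_le hω
  have hmn : (m : ℝ) ≤ n := by
    exact_mod_cast (Nat.le_mul_of_pos_left m (by omega)).trans h.mul_le
  set D := chernoffInfo (binomial m p) (binomial m q)
  set V := m.choose k * min ((p : ℝ) ^ k * (1 - p) ^ l) ((q : ℝ) ^ k * (1 - q) ^ l)
  calc γ / 2 * (Real.exp (-4) * (ε / ω)) * (1 / √(n * p) * Real.exp (-D))
      ≤ s / n / 2 * (Real.exp (-4) * (ε / ω)) * (1 / √(m * p) * Real.exp (-D)) := by gcongr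
    _ = s / n / 2 * (Real.exp (-4) * (ε / ω) * (1 / √(m * p) * Real.exp (-D))) := by ring
    _ ≤ s / n / 2 * V := mul_le_mul_of_nonneg_left hV (by positivity)
    _ = 1 / n * (s * (V / 2)) := by ring

end SBM

theorem mainTheorem5_general {β ε ω : ℝ} (hβ : 1 < β) (hε : 0 < ε) (hω : 0 < ω) (Kstar : ℕ) :
    ∃ C : ℝ, 0 < C ∧ ∃ c : ℝ, 0 < c ∧ ∀ (ω' : ℝ) (n K : ℕ) (pstar q : unitInterval),
      3 ≤ K → K ≤ Kstar → C ≤ (n : ℝ) * pstar → 0 < (q : ℝ) → (q : ℝ) ≤ pstar →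
        (pstar : ℝ) ≤ 1 - ε → ω' ≤ (pstar : ℝ) / q → (pstar : ℝ) / q ≤ ω →
        c * (1 / √((n : ℝ) * pstar) *
            Real.exp (-chernoffInfo (binomial (n / K) pstar) (binomial (n / K) q))) ≤
          SBM.minimaxRisk (SBM.paramSpace β ε ω ω' n pstar K
            (chernoffInfo (binomial (n / K) pstar) (binomial (n / K) q))) := by
  obtain ⟨γ, hγ, X, hX⟩ := SBM.exists_forall_ge_blockSizes hβ Kstar
  set Y := max X (max 2 (max (2 * ω) (4 / ε)))
  obtain ⟨hXY, h2Y, hωY, hεY⟩ : X ≤ Y ∧ 2 ≤ Y ∧ 2 * ω ≤ Y ∧ 4 / ε ≤ Y := by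
    simp only [Y, le_max_iff, le_refl, true_or, or_true, and_self]
  refine ⟨(Kstar + 1) * Y, by positivity, γ / 2 * (Real.exp (-4) * (ε / ω)), by positivity,
    fun ω' n K p q hK hKK hn hq hqp hpε hω'p hpω => ?_⟩
  have hK0 : (0 : ℝ) < K := by exact_mod_cast (by omega : 0 < K)
  have hKK' : (K : ℝ) ≤ Kstar := by exact_mod_cast hKK
  have hYp : Y ≤ (n : ℝ) / K * p := by
    rw [div_mul_eq_mul_div, le_div_iff₀ hK0, mul_comm]
    exact (mul_le_mul_of_nonneg_right (by linarith) (by linarith)).trans hn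
  have hY : Y ≤ (n : ℝ) / K := hYp.trans (mul_le_of_le_one_right (by positivity) p.2.2)
  have hm : (n : ℝ) / K / 2 ≤ (n / K : ℕ) := by linarith [lt_natDiv_add_one n K]
  have hmq : 1 ≤ ((n / K : ℕ) : ℝ) * q := by
    have hωq : 2 * ω ≤ (n : ℝ) / K * q * ω := by
      rw [mul_assoc, mul_comm (q : ℝ)]
      exact hωY.trans (hYp.trans (mul_le_mul_of_nonneg_left ((div_le_iff₀ hq).1 hpω)
        (by positivity)))
    linarith [le_of_mul_le_mul_right hωq hω, mul_le_mul_of_nonneg_right hm hq.le]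
  have hmε : 2 ≤ ((n / K : ℕ) : ℝ) * ε := by
    linarith [(div_le_iff₀ hε).1 (hεY.trans hY), mul_le_mul_of_nonneg_right hm hε.le]
  obtain ⟨s, hsizes, hs⟩ := hX n K (by omega) hKK (hXY.trans hY)
  exact SBM.le_minimaxRisk_of_blockSizes hK hsizes hs hε hq hqp hpε hω'p hpω hmq hmε

theorem mainTheorem5 (β ε ω ω' : ℝ) (Kstar : ℕ)
    (hβ : 1 < β) (hε : ε ∈ Set.Ioo (0 : ℝ) 1) (hω : 1 < ω) (hω' : 1 < ω') :
    ∃ C : ℝ, 0 < C ∧ ∃ c : ℝ, 0 < c ∧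
      ∀ (n K : ℕ) (pstar : unitInterval) (Dstar : ℝ),
        3 ≤ K → K ≤ Kstar → C ≤ (n : ℝ) * pstar →
        (∃ q : unitInterval, 0 < (q : ℝ) ∧ (q : ℝ) < pstar ∧ (pstar : ℝ) ≤ 1 - ε ∧
          ω' ≤ (pstar : ℝ) / q ∧ (pstar : ℝ) / q ≤ ω ∧
          Dstar = chernoffInfo (binomial (n / K) pstar) (binomial (n / K) q)) →
        c * (1 / Real.sqrt ((n : ℝ) * pstar) * Real.exp (-Dstar)) ≤
          SBM.minimaxRisk (SBM.paramSpace β ε ω ω' n pstar K Dstar) := by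
  obtain ⟨C, hC, c, hc, h⟩ := mainTheorem5_general hβ hε.1 (one_pos.trans hω) Kstar
  refine ⟨C, hC, c, hc, ?_⟩
  rintro n K pstar _ hK hKK hn ⟨q, hq, hqp, hpε, hω'p, hpω, rfl⟩
  exact h ω' n K pstar q hK hKK hn hq hqp.le hpε hω'p hpω
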